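/- Let $X$ be a locally compact metrizable space of finite covering dimension, i.e. for some $n\in\mathbb N$ every finite open cover of $X$ has a finite open refinement such that each point of $X$ lies in at most $n+1$ of its members. Let $A$ be a separable $\mathcal C_0(X)$-algebra, i.e. a separable $C^*$-algebra together with a $^*$-homomorphism $\mu\colon \mathcal C_0(X)\to \mathcal Z(\mathcal M(A))$ into the center of the multiplier algebra of $A$ such that, for some approximate unit $(h_\nu)$ of $\mathcal C_0(X)$, $\|\mu(h_\nu)a-a\|\to 0$ for every $a\in A$. For $x\in X$ let $J_x$ be the closed ideal of $A$ generated by the products $\mu(f)a$ with $a\in A$ and $f\in\mathcal C_0(X)$, $f(x)=0$ (their closed linear span), and let $A_x=A/J_x$ be the fibre of $A$ at $x$. Call a $C^*$-algebra $B$ stable if $B\cong B\otimes\mathcal K$, where $\mathcal K$ is the $C^*$-algebra of compact operators on $\ell^2(\mathbb N)$. Then $A$ is stable if and only if $A_x$ is stable for every $x\in X$. -/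

import Mathlib

open Filter Topology
open scoped TensorProduct ZeroAtInfty MultiplierAlgebra

noncomputable section

/-- A pre-C⋆-algebra: a complex `*`-algebra with a submultiplicative seminorm satisfying the
C⋆-identity (neither separation nor completeness is required). -/
class PreCStarAlgebra (T : Type*) extends NonUnitalSeminormedRing T, StarRing T,
    NormedSpace ℂ T, IsScalarTower ℂ T T, SMulCommClass ℂ T T, StarModule ℂ T where
  norm_star_mul_self' : ∀ x : T, ‖star x * x‖ = ‖x‖ * ‖x‖

namespace PreCStarAlgebra

variable {T : Type*} [PreCStarAlgebra T]

theorem norm_star_le (x : T) : ‖star x‖ ≤ ‖x‖ := by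
  have key : ∀ y : T, ‖y‖ ≤ ‖star y‖ := fun y => by
    rcases (norm_nonneg y).eq_or_lt with h | h
    · rw [← h]; exact norm_nonneg _
    · refine le_of_mul_le_mul_right ?_ h
      rw [← norm_star_mul_self']
      exact norm_mul_le _ _
  simpa using key (star x)

theorem norm_star' (x : T) : ‖star x‖ = ‖x‖ :=
  le_antisymm (norm_star_le x) (by simpa using norm_star_le (star x))

theorem isometry_star : Isometry (star : T → T) :=
  AddMonoidHomClass.isometry_of_norm (starAddEquiv : T ≃+ T) norm_star'

variable (T) in
/-- The Hausdorff completion of a pre-C⋆-algebra; it is a C⋆-algebra. -/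
def CStarCompletion : Type _ := UniformSpace.Completion T

namespace CStarCompletion

open UniformSpace

instance : NormedAddCommGroup (CStarCompletion T) :=
  inferInstanceAs (NormedAddCommGroup (Completion T))

instance : NormedSpace ℂ (CStarCompletion T) :=
  inferInstanceAs (NormedSpace ℂ (Completion T))

instance : CompleteSpace (CStarCompletion T) :=
  inferInstanceAs (CompleteSpace (Completion T))

/-- The canonical map into the completion. -/
def of (x : T) : CStarCompletion T := (x : Completion T)

theorem continuous_of : Continuous (of : T → CStarCompletion T) := Completion.continuous_coe T

theorem isDenseInducing_of : IsDenseInducing (of : T → CStarCompletion T) :=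
  Completion.isDenseInducing_coe

theorem norm_of (x : T) : ‖of x‖ = ‖x‖ := Completion.norm_coe x
theorem of_add (x y : T) : of (x + y) = of x + of y := Completion.coe_add x y
theorem of_zero : of (0 : T) = 0 := rfl
theorem of_smul (c : ℂ) (x : T) : of (c • x) = c • of x := Completion.coe_smul c x

theorem induction₁ {p : CStarCompletion T → Prop} (a : CStarCompletion T)
    (hp : IsClosed {a | p a}) (ih : ∀ a : T, p (of a)) : p a :=
  Completion.induction_on a hp ih

theorem induction₂ {p : CStarCompletion T → CStarCompletion T → Prop} (a b : CStarCompletion T)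
    (hp : IsClosed {x : CStarCompletion T × CStarCompletion T | p x.1 x.2})
    (ih : ∀ a b : T, p (of a) (of b)) : p a b :=
  Completion.induction_on₂ a b hp ih

theorem induction₃ {p : CStarCompletion T → CStarCompletion T → CStarCompletion T → Prop}
    (a b c : CStarCompletion T)
    (hp : IsClosed {x : CStarCompletion T × CStarCompletion T × CStarCompletion T |
      p x.1 x.2.1 x.2.2})
    (ih : ∀ a b c : T, p (of a) (of b) (of c)) : p a b c :=
  Completion.induction_on₃ a b c hp ih

/-- Multiplication, extended by continuity. -/
instance : Mul (CStarCompletion T) where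
  mul x y := (isDenseInducing_of.prodMap isDenseInducing_of).extend
    (fun p : T × T => of (p.1 * p.2)) (x, y)

theorem of_mul (x y : T) : of (x * y) = of x * of y :=
  ((isDenseInducing_of.prodMap isDenseInducing_of).extend_eq
    (continuous_of.comp continuous_mul) (x, y)).symm

instance : ContinuousMul (CStarCompletion T) where
  continuous_mul := by
    let e : T →+ CStarCompletion T :=
      { toFun := of, map_zero' := of_zero, map_add' := of_add }
    let m := (AddMonoidHom.mul : T →+ T →+ T).compr₂ e
    have : Continuous fun p : T × T => m p.1 p.2 := continuous_of.comp continuous_mul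
    have di : IsDenseInducing (e : T → CStarCompletion T) := isDenseInducing_of
    exact (di.extend_Z_bilin di this :)

/-- The involution, extended by continuity. -/
instance : Star (CStarCompletion T) where
  star := Completion.map star

theorem of_star (x : T) : of (star x) = star (of x) :=
  (Completion.map_coe isometry_star.uniformContinuous x).symm

instance : ContinuousStar (CStarCompletion T) where
  continuous_star := Completion.continuous_map

instance : NonUnitalRing (CStarCompletion T) where
  __ := (inferInstance : AddCommGroup (CStarCompletion T))
  left_distrib a b c := by
    refine induction₃ (p := fun a b c => a * (b + c) = a * b + a * c) a b c
      (isClosed_eq (by fun_prop) (by fun_prop)) fun a b c => ?_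
    simp only [← of_add, ← of_mul, mul_add]
  right_distrib a b c := by
    refine induction₃ (p := fun a b c => (a + b) * c = a * c + b * c) a b c
      (isClosed_eq (by fun_prop) (by fun_prop)) fun a b c => ?_
    simp only [← of_add, ← of_mul, add_mul]
  zero_mul a := by
    refine induction₁ (p := fun a => 0 * a = 0) a
      (isClosed_eq (by fun_prop) (by fun_prop)) fun a => ?_
    rw [← of_zero, ← of_mul, zero_mul]
  mul_zero a := by
    refine induction₁ (p := fun a => a * 0 = 0) a
      (isClosed_eq (by fun_prop) (by fun_prop)) fun a => ?_
    rw [← of_zero, ← of_mul, mul_zero]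
  mul_assoc a b c := by
    refine induction₃ (p := fun a b c => a * b * c = a * (b * c)) a b c
      (isClosed_eq (by fun_prop) (by fun_prop)) fun a b c => ?_
    simp only [← of_mul, mul_assoc]

instance : NonUnitalNormedRing (CStarCompletion T) where
  __ := (inferInstance : NonUnitalRing (CStarCompletion T))
  __ := (inferInstance : NormedAddCommGroup (CStarCompletion T))
  norm_mul_le a b := by
    refine induction₂ (p := fun a b => ‖a * b‖ ≤ ‖a‖ * ‖b‖) a b
      (isClosed_le (by fun_prop) (by fun_prop)) fun a b => ?_
    simpa only [← of_mul, norm_of] using norm_mul_le a b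

instance : StarRing (CStarCompletion T) where
  star_involutive a := by
    refine induction₁ (p := fun a => star (star a) = a) a
      (isClosed_eq (by fun_prop) (by fun_prop)) fun a => ?_
    simp only [← of_star, star_star]
  star_mul a b := by
    refine induction₂ (p := fun a b => star (a * b) = star b * star a) a b
      (isClosed_eq (by fun_prop) (by fun_prop)) fun a b => ?_
    simp only [← of_star, ← of_mul, star_mul]
  star_add a b := by
    refine induction₂ (p := fun a b => star (a + b) = star a + star b) a b
      (isClosed_eq (by fun_prop) (by fun_prop)) fun a b => ?_
    simp only [← of_star, ← of_add, star_add]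

instance : CStarRing (CStarCompletion T) where
  norm_mul_self_le a := by
    refine induction₁ (p := fun a => ‖a‖ * ‖a‖ ≤ ‖star a * a‖) a
      (isClosed_le (by fun_prop) (by fun_prop)) fun a => ?_
    rw [← of_star, ← of_mul, norm_of, norm_of, norm_star_mul_self']

instance : IsScalarTower ℂ (CStarCompletion T) (CStarCompletion T) where
  smul_assoc c a b := by
    refine induction₂ (p := fun a b => (c • a) * b = c • (a * b)) a b
      (isClosed_eq (((continuous_const_smul c).comp continuous_fst).mul continuous_snd)
        ((continuous_const_smul c).comp continuous_mul)) fun a b => ?_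
    rw [← of_smul, ← of_mul, ← of_mul, ← of_smul, smul_mul_assoc]

instance : SMulCommClass ℂ (CStarCompletion T) (CStarCompletion T) where
  smul_comm c a b := by
    refine induction₂ (p := fun a b => c • (a * b) = a * (c • b)) a b
      (isClosed_eq ((continuous_const_smul c).comp continuous_mul)
        (continuous_fst.mul ((continuous_const_smul c).comp continuous_snd))) fun a b => ?_
    rw [← of_smul, ← of_mul, ← of_mul, ← of_smul, mul_smul_comm]

instance : StarModule ℂ (CStarCompletion T) where
  star_smul c a := by
    refine induction₁ (p := fun a => star (c • a) = star c • star a) a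
      (isClosed_eq (continuous_star.comp (continuous_const_smul c))
        ((continuous_const_smul (star c)).comp continuous_star)) fun a => ?_
    rw [← of_smul, ← of_star, ← of_star, ← of_smul, star_smul]

instance : NonUnitalCStarAlgebra (CStarCompletion T) where

end CStarCompletion
end PreCStarAlgebra

namespace CStarTensor

variable (A B : Type*) [NonUnitalCStarAlgebra A] [NonUnitalCStarAlgebra B]

/-- A C⋆-seminorm on the algebraic tensor product `A ⊙ B` of two C⋆-algebras. (Every C⋆-seminorm
on `A ⊙ B` satisfies `tmul_le` automatically.) -/
structure IsCStarTensorSeminorm (p : Seminorm ℂ (A ⊗[ℂ] B)) : Prop where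
  mul_le : ∀ x y, p (x * y) ≤ p x * p y
  star_mul_self : ∀ x, p (star x * x) = p x * p x
  tmul_le : ∀ (a : A) (b : B), p (a ⊗ₜ[ℂ] b) ≤ ‖a‖ * ‖b‖

theorem isCStarTensorSeminorm_zero : IsCStarTensorSeminorm A B 0 where
  mul_le _ _ := by simp
  star_mul_self _ := by simp
  tmul_le a b := by simpa using mul_nonneg (norm_nonneg a) (norm_nonneg b)

theorem bddAbove_apply (x : A ⊗[ℂ] B) :
    BddAbove (Set.range fun p : {p // IsCStarTensorSeminorm A B p} => p.1 x) := by
  induction x using TensorProduct.induction_on with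
  | zero => exact ⟨0, by rintro _ ⟨p, rfl⟩; simp⟩
  | tmul a b => exact ⟨‖a‖ * ‖b‖, by rintro _ ⟨p, rfl⟩; exact p.2.tmul_le a b⟩
  | add x y hx hy =>
    obtain ⟨C, hC⟩ := hx
    obtain ⟨D, hD⟩ := hy
    refine ⟨C + D, ?_⟩
    rintro _ ⟨p, rfl⟩
    exact (map_add_le_add p.1 x y).trans (add_le_add (hC ⟨p, rfl⟩) (hD ⟨p, rfl⟩))

instance : Nonempty {p // IsCStarTensorSeminorm A B p} := ⟨⟨0, isCStarTensorSeminorm_zero A B⟩⟩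

/-- The maximal C⋆-norm on `A ⊙ B`: the supremum of all C⋆-seminorms. -/
def maxSeminorm : Seminorm ℂ (A ⊗[ℂ] B) :=
  Seminorm.ofSMulLE (fun x => ⨆ p : {p // IsCStarTensorSeminorm A B p}, p.1 x)
    (by simp)
    (fun x y => ciSup_le fun p => (map_add_le_add p.1 x y).trans
      (add_le_add (le_ciSup (bddAbove_apply A B x) p) (le_ciSup (bddAbove_apply A B y) p)))
    (fun c x => ciSup_le fun p => by
      rw [map_smul_eq_mul]
      exact mul_le_mul_of_nonneg_left (le_ciSup (bddAbove_apply A B x) p) (norm_nonneg c))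

theorem le_maxSeminorm (p : Seminorm ℂ (A ⊗[ℂ] B)) (hp : IsCStarTensorSeminorm A B p)
    (x : A ⊗[ℂ] B) : p x ≤ maxSeminorm A B x :=
  le_ciSup (bddAbove_apply A B x) ⟨p, hp⟩

theorem isCStarTensorSeminorm_maxSeminorm : IsCStarTensorSeminorm A B (maxSeminorm A B) where
  mul_le x y := ciSup_le fun p => (p.2.mul_le x y).trans
    (mul_le_mul (le_maxSeminorm A B _ p.2 x) (le_maxSeminorm A B _ p.2 y)
      (apply_nonneg _ _) (apply_nonneg _ _))
  star_mul_self x := by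
    refine le_antisymm (ciSup_le fun p => ?_) ?_
    · rw [p.2.star_mul_self]
      exact mul_self_le_mul_self (apply_nonneg _ _) (le_maxSeminorm A B _ p.2 x)
    · rw [← pow_two, ← Real.le_sqrt (apply_nonneg _ _) (apply_nonneg _ _)]
      refine ciSup_le fun p => Real.le_sqrt_of_sq_le ?_
      rw [pow_two, ← p.2.star_mul_self]
      exact le_maxSeminorm A B _ p.2 _
  tmul_le a b := ciSup_le fun p => p.2.tmul_le a b

/-- The algebraic tensor product `A ⊙ B`, equipped with the maximal C⋆-norm. -/
def AlgTensor : Type _ := A ⊗[ℂ] B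

instance : NonUnitalRing (AlgTensor A B) := inferInstanceAs (NonUnitalRing (A ⊗[ℂ] B))
instance : Module ℂ (AlgTensor A B) := inferInstanceAs (Module ℂ (A ⊗[ℂ] B))
instance : StarRing (AlgTensor A B) := inferInstanceAs (StarRing (A ⊗[ℂ] B))
instance : StarModule ℂ (AlgTensor A B) := inferInstanceAs (StarModule ℂ (A ⊗[ℂ] B))
instance : IsScalarTower ℂ (AlgTensor A B) (AlgTensor A B) :=
  inferInstanceAs (IsScalarTower ℂ (A ⊗[ℂ] B) (A ⊗[ℂ] B))
instance : SMulCommClass ℂ (AlgTensor A B) (AlgTensor A B) :=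
  inferInstanceAs (SMulCommClass ℂ (A ⊗[ℂ] B) (A ⊗[ℂ] B))

instance : SeminormedAddCommGroup (AlgTensor A B) :=
  (maxSeminorm A B).toAddGroupSeminorm.toSeminormedAddCommGroup

instance : NonUnitalSeminormedRing (AlgTensor A B) where
  __ := (inferInstance : NonUnitalRing (AlgTensor A B))
  __ := (inferInstance : SeminormedAddCommGroup (AlgTensor A B))
  norm_mul_le := (isCStarTensorSeminorm_maxSeminorm A B).mul_le

instance : PreCStarAlgebra (AlgTensor A B) where
  norm_smul_le c x := (map_smul_eq_mul (maxSeminorm A B) c x).le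
  norm_star_mul_self' := (isCStarTensorSeminorm_maxSeminorm A B).star_mul_self

end CStarTensor

/-- The maximal C⋆-tensor product of `A` and `B`. If one of the factors is nuclear, as is the case
for the compact operators, then `A ⊙ B` has only one C⋆-norm, and this is *the* C⋆-tensor product
`A ⊗ B`. -/
def CStarTensor (A B : Type*) [NonUnitalCStarAlgebra A] [NonUnitalCStarAlgebra B] : Type _ :=
  PreCStarAlgebra.CStarCompletion (CStarTensor.AlgTensor A B)

instance (A B : Type*) [NonUnitalCStarAlgebra A] [NonUnitalCStarAlgebra B] :
    NonUnitalCStarAlgebra (CStarTensor A B) :=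
  inferInstanceAs (NonUnitalCStarAlgebra
    (PreCStarAlgebra.CStarCompletion (CStarTensor.AlgTensor A B)))

theorem isCompactOperator_adjoint {H : Type*} [NormedAddCommGroup H] [InnerProductSpace ℂ H]
    [CompleteSpace H] {T : H →L[ℂ] H} (hT : IsCompactOperator T) :
    IsCompactOperator (star T : H →L[ℂ] H) := by
  have hS : IsCompactOperator (T * star T : H →L[ℂ] H) := hT.comp_clm (star T)
  refine (isCompactOperator_iff_isCompact_closure_image_closedBall
    ((star T : H →L[ℂ] H) : H →ₗ[ℂ] H) zero_lt_one).2 ?_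
  refine TotallyBounded.isCompact_of_isClosed (TotallyBounded.closure ?_) isClosed_closure
  have hS' := (IsCompactOperator.isCompact_closure_image_closedBall
    (f := ((T * star T : H →L[ℂ] H) : H →ₗ[ℂ] H)) hS 1).totallyBounded.subset subset_closure
  rw [Metric.totallyBounded_iff]
  intro ε hε
  obtain ⟨u, hu, huf, hcov⟩ := Set.exists_subset_image_finite_and.1
    (totallyBounded_iff_subset.1 hS' _
      (Metric.dist_mem_uniformity (show (0 : ℝ) < ε ^ 2 / 2 by positivity)))
  refine ⟨(fun x => (star T : H →L[ℂ] H) x) '' u, huf.image _, ?_⟩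
  rintro _ ⟨x, hx, rfl⟩
  obtain ⟨_, ⟨y, hy, rfl⟩, hxy⟩ := Set.mem_iUnion₂.1 (hcov ⟨x, hx, rfl⟩)
  refine Set.mem_iUnion₂.2 ⟨_, ⟨y, hy, rfl⟩, ?_⟩
  have hd : ‖(T * star T) (x - y)‖ < ε ^ 2 / 2 := by
    rw [map_sub]; simpa [dist_eq_norm] using hxy
  have hn : ‖x - y‖ ≤ 2 := by
    have h1 : ‖x‖ ≤ 1 := by simpa using hx
    have h2 : ‖y‖ ≤ 1 := by simpa using hu hy
    exact (norm_sub_le _ _).trans (by linarith)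
  have key : ‖(star T) (x - y)‖ ^ 2 ≤ ‖x - y‖ * ‖(T * star T) (x - y)‖ := by
    have h : inner ℂ ((star T) (x - y)) ((star T) (x - y)) =
        inner ℂ (x - y) ((T * star T) (x - y)) := by
      rw [ContinuousLinearMap.star_eq_adjoint, ContinuousLinearMap.adjoint_inner_left]
      rfl
    rw [inner_self_eq_norm_sq_to_K] at h
    have h' := congrArg norm h
    rw [norm_pow, RCLike.norm_ofReal, abs_norm] at h'
    rw [h']
    exact norm_inner_le_norm _ _
  have hlt : ‖(star T) (x - y)‖ ^ 2 < ε ^ 2 := by nlinarith [norm_nonneg ((T * star T) (x - y))]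
  rw [Metric.mem_ball, dist_eq_norm]
  change ‖(star T) x - (star T) y‖ < ε
  rw [← map_sub]
  exact lt_of_pow_lt_pow_left₀ 2 hε.le hlt

/-- The C⋆-algebra of compact operators on a Hilbert space. -/
def compactOperators (H : Type*) [NormedAddCommGroup H] [InnerProductSpace ℂ H]
    [CompleteSpace H] : NonUnitalStarSubalgebra ℂ (H →L[ℂ] H) where
  carrier := {T | IsCompactOperator T}
  add_mem' := IsCompactOperator.add
  zero_mem' := isCompactOperator_zero
  mul_mem' {_ b} ha _ := IsCompactOperator.comp_clm ha b
  smul_mem' c _ ha := ha.smul c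
  star_mem' ha := isCompactOperator_adjoint ha

instance (H : Type*) [NormedAddCommGroup H] [InnerProductSpace ℂ H] [CompleteSpace H] :
    IsClosed (compactOperators H : Set (H →L[ℂ] H)) :=
  isClosed_setOfPred_isCompactOperator (𝕜₁ := ℂ) (𝕜₂ := ℂ) (σ₁₂ := RingHom.id ℂ) (M₁ := H) (M₂ := H)

/-- The C⋆-algebra `𝒦` of compact operators on the separable infinite-dimensional Hilbert space
`ℓ²(ℕ)`. -/
abbrev StdCompacts : Type := compactOperators (lp (fun _ : ℕ => ℂ) 2)

/-- A C⋆-algebra `A` is stable if it is `*`-isomorphic to `A ⊗ 𝒦`. -/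
def IsStable (A : Type*) [NonUnitalCStarAlgebra A] : Prop :=
  Nonempty (A ≃⋆ₐ[ℂ] CStarTensor A StdCompacts)

/-- `J` is a closed two-sided `*`-ideal of the C⋆-algebra `A`. -/
class IsClosedStarIdeal {A : Type*} [NonUnitalCStarAlgebra A] (J : Submodule ℂ A) : Prop where
  isClosed : IsClosed (J : Set A)
  mul_mem_left : ∀ (a : A) {j : A}, j ∈ J → a * j ∈ J
  mul_mem_right : ∀ {j : A} (a : A), j ∈ J → j * a ∈ J
  star_mem : ∀ {j : A}, j ∈ J → star j ∈ J

/-- The quotient C⋆-algebra `A / J`, with the quotient norm. -/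
def CStarQuotient {A : Type*} [NonUnitalCStarAlgebra A] (J : Submodule ℂ A) : Type _ := A ⧸ J

namespace CStarQuotient

variable {A : Type*} [NonUnitalCStarAlgebra A] (J : Submodule ℂ A) [IsClosedStarIdeal J]

instance : IsClosed (J : Set A) := IsClosedStarIdeal.isClosed

instance : NormedAddCommGroup (CStarQuotient J) := inferInstanceAs (NormedAddCommGroup (A ⧸ J))
instance : NormedSpace ℂ (CStarQuotient J) := inferInstanceAs (NormedSpace ℂ (A ⧸ J))
instance : CompleteSpace (CStarQuotient J) := inferInstanceAs (CompleteSpace (A ⧸ J))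

/-- The quotient map `A → A / J`. -/
def mk : A →ₗ[ℂ] CStarQuotient J := J.mkQ

theorem mk_surjective : Function.Surjective (mk J) := J.mkQ_surjective

theorem mk_eq_mk {a b : A} : mk J a = mk J b ↔ a - b ∈ J := Submodule.Quotient.eq J

theorem mk_eq_zero {a : A} : mk J a = 0 ↔ a ∈ J := Submodule.Quotient.mk_eq_zero J

theorem norm_mk_le (a : A) : ‖mk J a‖ ≤ ‖a‖ := Submodule.Quotient.norm_mk_le J a

theorem exists_mk_eq_norm_lt (x : CStarQuotient J) {ε : ℝ} (hε : 0 < ε) :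
    ∃ a, mk J a = x ∧ ‖a‖ < ‖x‖ + ε := Submodule.Quotient.norm_mk_lt x hε

instance : Mul (CStarQuotient J) where
  mul := Quotient.map₂ (· * ·) fun a b h c d h' => by
    rw [← Quotient.eq_iff_equiv] at h h' ⊢
    have h₁ : a - b ∈ J := (mk_eq_mk J).1 h
    have h₂ : c - d ∈ J := (mk_eq_mk J).1 h'
    refine (mk_eq_mk J).2 ?_
    have : a * c - b * d = (a - b) * c + b * (c - d) := by noncomm_ring
    rw [this]
    exact J.add_mem (IsClosedStarIdeal.mul_mem_right c h₁) (IsClosedStarIdeal.mul_mem_left b h₂)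

instance : Star (CStarQuotient J) where
  star := Quotient.map star fun a b h => by
    rw [← Quotient.eq_iff_equiv] at h ⊢
    have h₁ : a - b ∈ J := (mk_eq_mk J).1 h
    refine (mk_eq_mk J).2 ?_
    rw [← star_sub]
    exact IsClosedStarIdeal.star_mem h₁

theorem mk_mul (a b : A) : mk J (a * b) = mk J a * mk J b := rfl
theorem mk_star (a : A) : mk J (star a) = star (mk J a) := rfl

instance : NonUnitalRing (CStarQuotient J) where
  __ := (inferInstance : AddCommGroup (CStarQuotient J))
  left_distrib := by
    intro a b c
    obtain ⟨a, rfl⟩ := mk_surjective J a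
    obtain ⟨b, rfl⟩ := mk_surjective J b
    obtain ⟨c, rfl⟩ := mk_surjective J c
    simp only [← map_add, ← mk_mul, mul_add]
  right_distrib := by
    intro a b c
    obtain ⟨a, rfl⟩ := mk_surjective J a
    obtain ⟨b, rfl⟩ := mk_surjective J b
    obtain ⟨c, rfl⟩ := mk_surjective J c
    simp only [← map_add, ← mk_mul, add_mul]
  zero_mul := by
    intro a
    obtain ⟨a, rfl⟩ := mk_surjective J a
    rw [← map_zero (mk J), ← mk_mul, zero_mul]
  mul_zero := by
    intro a
    obtain ⟨a, rfl⟩ := mk_surjective J a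
    rw [← map_zero (mk J), ← mk_mul, mul_zero]
  mul_assoc := by
    intro a b c
    obtain ⟨a, rfl⟩ := mk_surjective J a
    obtain ⟨b, rfl⟩ := mk_surjective J b
    obtain ⟨c, rfl⟩ := mk_surjective J c
    simp only [← mk_mul, mul_assoc]

instance : NonUnitalNormedRing (CStarQuotient J) where
  __ := (inferInstance : NonUnitalRing (CStarQuotient J))
  __ := (inferInstance : NormedAddCommGroup (CStarQuotient J))
  norm_mul_le x y := by
    refine le_of_forall_gt_imp_ge_of_dense fun c hc => ?_
    have h : Tendsto (fun ε : ℝ => (‖x‖ + ε) * (‖y‖ + ε)) (𝓝[>] 0) (𝓝 (‖x‖ * ‖y‖)) := by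
      have : Continuous fun ε : ℝ => (‖x‖ + ε) * (‖y‖ + ε) := by fun_prop
      simpa using (this.tendsto 0).mono_left nhdsWithin_le_nhds
    obtain ⟨ε, hεc, hε⟩ := ((h.eventually_lt_const hc).and self_mem_nhdsWithin).exists
    obtain ⟨a, rfl, ha⟩ := exists_mk_eq_norm_lt J x hε
    obtain ⟨b, rfl, hb⟩ := exists_mk_eq_norm_lt J y hε
    rw [← mk_mul]
    refine ((norm_mk_le J _).trans (norm_mul_le a b)).trans (le_trans ?_ hεc.le)
    gcongr

instance : StarRing (CStarQuotient J) where
  star_involutive := by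
    intro a
    obtain ⟨a, rfl⟩ := mk_surjective J a
    simp only [← mk_star, star_star]
  star_mul := by
    intro a b
    obtain ⟨a, rfl⟩ := mk_surjective J a
    obtain ⟨b, rfl⟩ := mk_surjective J b
    simp only [← mk_star, ← mk_mul, star_mul]
  star_add := by
    intro a b
    obtain ⟨a, rfl⟩ := mk_surjective J a
    obtain ⟨b, rfl⟩ := mk_surjective J b
    simp only [← mk_star, ← map_add, star_add]

/-- A closed two-sided `*`-ideal, viewed as a C⋆-subalgebra. -/
def toStarSubalgebra : NonUnitalStarSubalgebra ℂ A where
  carrier := J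
  add_mem' := J.add_mem
  zero_mem' := J.zero_mem
  mul_mem' {a _} _ hb := IsClosedStarIdeal.mul_mem_left a hb
  smul_mem' c _ h := J.smul_mem c h
  star_mem' := IsClosedStarIdeal.star_mem

theorem norm_mk_mul_self_le (a : A) : ‖mk J a‖ * ‖mk J a‖ ≤ ‖mk J (star a * a)‖ := by
  refine le_of_forall_pos_lt_add fun ε hε => ?_
  obtain ⟨c, hc, hcn⟩ := exists_mk_eq_norm_lt J (mk J (star a * a)) (half_pos hε)
  have hj : star a * a - c ∈ J := (mk_eq_mk J).1 hc.symm
  set j := star a * a - c with hjdef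
  let I := toStarSubalgebra J
  have _ : IsClosed (I : Set A) := IsClosedStarIdeal.isClosed (J := J)
  let _ : PartialOrder I := CStarAlgebra.spectralOrder I
  have _ : StarOrderedRing I := CStarAlgebra.spectralOrderedRing I
  have hu := CStarAlgebra.increasingApproximateUnit I
  have _ := hu.neBot
  obtain ⟨e, he, he0, he1⟩ := (((Metric.tendsto_nhds.1 (hu.tendsto_mul_left ⟨j, hj⟩) _
    (half_pos hε)).and (hu.eventually_nonneg.and hu.eventually_norm))).exists
  obtain ⟨y, hy⟩ := CStarAlgebra.nonneg_iff_eq_star_mul_self.1 he0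
  have hue : ‖(1 : Unitization ℂ A) - ((e : A) : Unitization ℂ A)‖ ≤ 1 := by
    let _ : PartialOrder A := CStarAlgebra.spectralOrder A
    have _ : StarOrderedRing A := CStarAlgebra.spectralOrderedRing A
    have hA : 0 ≤ (e : A) := by
      rw [hy]
      exact star_mul_self_nonneg (y : A)
    have h0 : 0 ≤ ((e : A) : Unitization ℂ A) := Unitization.inr_nonneg_iff.2 hA
    have h1 : ((e : A) : Unitization ℂ A) ≤ 1 :=
      (CStarAlgebra.norm_le_one_iff_of_nonneg _ h0).1 (by simpa [Unitization.norm_inr] using he1)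
    exact (CStarAlgebra.norm_le_one_iff_of_nonneg _ (sub_nonneg.2 h1)).2 (sub_le_self _ h0)
  have hes : star (e : A) = e := by
    simpa using congrArg (Subtype.val) (IsSelfAdjoint.of_nonneg he0).star_eq
  have hej : ‖j - j * e‖ < ε / 2 := by
    rw [dist_comm] at he
    simpa [dist_eq_norm] using he
  have hae : mk J a = mk J (a - a * e) := by
    rw [mk_eq_mk]
    simpa using IsClosedStarIdeal.mul_mem_left a e.2
  set w : Unitization ℂ A := 1 - ((e : A) : Unitization ℂ A) with hw
  have hws : star w = w := by simp [hw, ← Unitization.inr_star, hes]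
  calc ‖mk J a‖ * ‖mk J a‖ ≤ ‖a - a * e‖ * ‖a - a * e‖ := by
        rw [hae]; exact mul_self_le_mul_self (norm_nonneg _) (norm_mk_le J _)
    _ = ‖star (a - a * e) * (a - a * e)‖ := CStarRing.norm_star_mul_self.symm
    _ = ‖w * ((star a * a : A) : Unitization ℂ A) * w‖ := by
        rw [← Unitization.norm_inr (𝕜 := ℂ)]
        congr 1
        have : ((a - a * e : A) : Unitization ℂ A) = (a : Unitization ℂ A) * w := by
          simp [hw, mul_sub]
        rw [Unitization.inr_mul, Unitization.inr_star, this, star_mul, hws, Unitization.inr_mul,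
          Unitization.inr_star]
        simp only [mul_assoc]
    _ = ‖w * (c : Unitization ℂ A) * w + w * ((j - j * e : A) : Unitization ℂ A)‖ := by
        congr 1
        have h1 : star a * a = c + j := by simp [hjdef]
        have h2 : ((j - j * e : A) : Unitization ℂ A) = (j : Unitization ℂ A) * w := by
          simp [hw, mul_sub]
        rw [h1, h2, Unitization.inr_add]
        noncomm_ring
    _ ≤ 1 * ‖c‖ * 1 + 1 * ‖j - j * e‖ := by
        refine (norm_add_le _ _).trans (add_le_add ?_ ?_)
        · refine (norm_mul_le _ _).trans ?_
          gcongr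
          refine (norm_mul_le _ _).trans ?_
          rw [Unitization.norm_inr]
          gcongr
        · refine (norm_mul_le _ _).trans ?_
          rw [Unitization.norm_inr]
          gcongr
    _ < ‖mk J (star a * a)‖ + ε := by linarith

instance : NonUnitalCStarAlgebra (CStarQuotient J) where
  norm_mul_self_le := by
    intro a
    obtain ⟨a, rfl⟩ := mk_surjective J a
    exact norm_mk_mul_self_le J a
  smul_assoc c := by
    intro a b
    obtain ⟨a, rfl⟩ := mk_surjective J a
    obtain ⟨b, rfl⟩ := mk_surjective J b
    simp only [smul_eq_mul, ← map_smul, ← mk_mul, smul_mul_assoc]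
  smul_comm c := by
    intro a b
    obtain ⟨a, rfl⟩ := mk_surjective J a
    obtain ⟨b, rfl⟩ := mk_surjective J b
    simp only [smul_eq_mul, ← map_smul, ← mk_mul, mul_smul_comm]
  star_smul c := by
    intro a
    obtain ⟨a, rfl⟩ := mk_surjective J a
    simp only [← map_smul, ← mk_star, star_smul]

end CStarQuotient

/-- A `C₀(X)`-algebra structure on a C⋆-algebra `A`: a `*`-homomorphism from `C₀(X)` into the
center of the multiplier algebra of `A` such that, for some approximate unit `(h)` of `C₀(X)`,
`h • a → a` for all `a : A`. (For a multiplier `m = (L, R)`, `m.fst a = L a` is the product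
`m a`.) -/
structure C0AlgebraStructure (X A : Type*) [TopologicalSpace X] [NonUnitalCStarAlgebra A] where
  /-- The structure map. -/
  toHom : C₀(X, ℂ) →⋆ₙₐ[ℂ] 𝓜(ℂ, A)
  mem_center : ∀ f, toHom f ∈ Set.center 𝓜(ℂ, A)
  nondegenerate : ∃ l : Filter C₀(X, ℂ), l.IsApproximateUnit ∧
    ∀ a : A, Tendsto (fun h => (toHom h).fst a) l (𝓝 a)

namespace C0AlgebraStructure

variable {X A : Type*} [TopologicalSpace X] [NonUnitalCStarAlgebra A]

/-- The product `f • a` of `f : C₀(X)` and `a : A`. -/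
def act (S : C0AlgebraStructure X A) (f : C₀(X, ℂ)) (a : A) : A := (S.toHom f).fst a

theorem eq_of_mul_right_eq {a b : A} (h : ∀ x : A, x * a = x * b) : a = b := by
  rw [← sub_eq_zero, ← CStarRing.star_mul_self_eq_zero_iff, mul_sub, h, sub_self]

theorem eq_of_mul_left_eq {a b : A} (h : ∀ x : A, a * x = b * x) : a = b := by
  rw [← sub_eq_zero, ← CStarRing.mul_star_self_eq_zero_iff, sub_mul, h, sub_self]

variable (S : C0AlgebraStructure X A)

theorem mul_act (f : C₀(X, ℂ)) (a b : A) : a * S.act f b = S.act f (a * b) := by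
  have h := ((S.mem_center f).comm (DoubleCentralizer.coe ℂ a)).eq
  have h' := congrArg (fun m : 𝓜(ℂ, A) => m.fst b) h
  exact h'.symm

theorem act_mul (f : C₀(X, ℂ)) (a b : A) : S.act f a * b = S.act f (a * b) := by
  refine eq_of_mul_right_eq fun x => ?_
  rw [act, act, ← mul_assoc, ← DoubleCentralizer.central, ← DoubleCentralizer.central, mul_assoc]

theorem star_act (f : C₀(X, ℂ)) (a : A) : star (S.act f a) = S.act (star f) (star a) := by
  have h1 : star (S.act f a) = (S.toHom (star f)).snd (star a) := by
    rw [map_star S.toHom f, DoubleCentralizer.star_snd, star_star]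
    rfl
  rw [h1]
  refine eq_of_mul_left_eq fun y => ?_
  rw [DoubleCentralizer.central, act_mul]
  exact S.mul_act _ _ _

/-- The closed ideal `J_x = C₀(X ∖ {x}) • A`, where `C₀(X ∖ {x})` is identified with the set of
functions in `C₀(X)` that vanish at `x`. -/
def fibreIdeal (x : X) : Submodule ℂ A :=
  (Submodule.span ℂ {b : A | ∃ (f : C₀(X, ℂ)) (a : A), f x = 0 ∧ b = S.act f a}).topologicalClosure

theorem map_mem_fibreIdeal {x : X} {φ : A → A} (hφ : Continuous φ) (h0 : φ 0 = 0)
    (hadd : ∀ a b, φ (a + b) = φ a + φ b) (hsmul : ∀ (c : ℂ) a, ∃ d : ℂ, φ (c • a) = d • φ a)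
    (hact : ∀ (f : C₀(X, ℂ)) (a : A), f x = 0 →
      ∃ (g : C₀(X, ℂ)) (b : A), g x = 0 ∧ φ (S.act f a) = S.act g b)
    {j : A} (hj : j ∈ S.fibreIdeal x) : φ j ∈ S.fibreIdeal x := by
  refine map_mem_closure hφ hj fun b hb => ?_
  induction hb using Submodule.span_induction with
  | mem b hb =>
    obtain ⟨f, a, hf, rfl⟩ := hb
    exact Submodule.subset_span (hact f a hf)
  | zero => rw [h0]; exact Submodule.zero_mem _
  | add a b _ _ ha hb => rw [hadd]; exact Submodule.add_mem _ ha hb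
  | smul c a _ ha =>
    obtain ⟨d, hd⟩ := hsmul c a
    rw [hd]
    exact Submodule.smul_mem _ d ha

instance (x : X) : IsClosedStarIdeal (S.fibreIdeal x) where
  isClosed := Submodule.isClosed_topologicalClosure _
  mul_mem_left a _ hj := S.map_mem_fibreIdeal (φ := fun b => a * b) (by fun_prop) (mul_zero a)
    (mul_add a) (fun c b => ⟨c, mul_smul_comm c a b⟩)
    (fun f b hf => ⟨f, a * b, hf, S.mul_act f a b⟩) hj
  mul_mem_right a hj := S.map_mem_fibreIdeal (φ := fun b => b * a) (by fun_prop) (zero_mul a)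
    (fun b c => add_mul b c a) (fun c b => ⟨c, smul_mul_assoc c b a⟩)
    (fun f b hf => ⟨f, b * a, hf, S.act_mul f b a⟩) hj
  star_mem hj := S.map_mem_fibreIdeal (φ := star) continuous_star (star_zero A) star_add
    (fun c b => ⟨star c, star_smul c b⟩)
    (fun f b hf => ⟨star f, star b, by simp [hf], S.star_act f b⟩) hj
/-- The fibre `A_x = A / J_x`. -/
abbrev Fibre (x : X) : Type _ := CStarQuotient (S.fibreIdeal x)

end C0AlgebraStructure

/-- `X` has covering dimension at most `n`: every finite open cover of `X` has a finite open
refinement such that each point lies in at most `n + 1` of its members. -/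
def CoveringDimLE (X : Type*) [TopologicalSpace X] (n : ℕ) : Prop :=
  ∀ 𝒰 : Set (Set X), 𝒰.Finite → (∀ U ∈ 𝒰, IsOpen U) → ⋃₀ 𝒰 = Set.univ →
    ∃ 𝒱 : Set (Set X), 𝒱.Finite ∧ (∀ V ∈ 𝒱, IsOpen V) ∧ ⋃₀ 𝒱 = Set.univ ∧
      (∀ V ∈ 𝒱, ∃ U ∈ 𝒰, V ⊆ U) ∧ ∀ x : X, {V | V ∈ 𝒱 ∧ x ∈ V}.encard ≤ n + 1

/-- `X` has finite covering dimension. -/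
def FiniteCoveringDim (X : Type*) [TopologicalSpace X] : Prop :=
  ∃ n : ℕ, CoveringDimLE X n

end

/-! For separable algebras stability is equivalent to an approximate, finitary property,
`HasOrthogonalCopies`: up to `ε`, any `star a * a` can be rewritten as `star x * x` with `x`
annihilated from the left by a given finite set. This property passes to quotients, which gives one
direction of the theorem. Being approximate and finitary, it can also be glued from the fibres,
which gives the other.

Stability gives the property because elements of `A ⊗ 𝒦` are nearly finite matrices, whose rows can
be shifted out of any corner (`IsMatrixSystem.hasOrthogonalCopies`). For the converse, a sequence
`t` in `ℓ¹(A)` defines `T : a ↦ (star (t n) * a)`. Orthogonal copies and Baire's theorem yield a `t`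
for which `T` has dense range and the `t n * A` together are dense
(`SummableSeq.exists_dense_range_adjL`). The polar decomposition of `T` identifies `A` with the
standard Hilbert module over `A`. This gives maps `s i` on `A` that preserve inner products and have
orthogonal ranges spanning `A` (`SummableSeq.exists_isometries`). Then `b * star c ↦ s i b * star (s
j c)` are the matrix units of an isomorphism `A ≅ A ⊗ 𝒦` (`isStable_of_isometries`). The space
`ℓ¹(A)` stands in for the Hilbert module: it is complete, and its sums converge absolutely.

For gluing, fibre norms are upper semicontinuous, so a witness in a fibre works near the point. In
dimension `n` a partition of unity on a compact set can be coloured by `n + 1` colours with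
orthogonal functions within each colour (`CoveringDimLE.exists_coloured_partition`). Witnesses are
chosen colour by colour, each nearly orthogonal to all possible witnesses of earlier colours, so
cross terms in `star x * x` are negligible. At each point at most `n + 1` functions are nonzero, so
by Cauchy–Schwarz the errors add up to a constant depending only on `n`
(`C0AlgebraStructure.norm_sum_act_le`). -/

/-! ### Matrix units in the compact operators -/

namespace StdCompacts

/-- The standard Hilbert basis of `ℓ²(ℕ)`. -/
noncomputable def basis : HilbertBasis ℕ ℂ (lp (fun _ : ℕ => ℂ) 2) :=
  HilbertBasis.ofRepr (LinearIsometryEquiv.refl ℂ _)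

/-- The standard matrix units in the algebra of compact operators. -/
noncomputable def unit (i j : ℕ) : StdCompacts :=
  ⟨InnerProductSpace.rankOne ℂ (basis i) (basis j), by
    change IsCompactOperator _
    rw [InnerProductSpace.rankOne_def']
    have h : IsCompactOperator (ContinuousLinearMap.toSpanSingleton ℂ (basis i)) :=
      isCompactOperator_of_locallyCompactSpace_rng _
    exact h.comp_clm (innerSL ℂ (basis j))⟩

theorem unit_mul_unit (i j k l : ℕ) :
    unit i j * unit k l = if j = k then unit i l else 0 := by
  apply Subtype.ext
  have h : (unit i j * unit k l : StdCompacts).1 =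
      InnerProductSpace.rankOne ℂ (basis i) (basis j) ∘L
        InnerProductSpace.rankOne ℂ (basis k) (basis l) := rfl
  rw [h, InnerProductSpace.rankOne_comp_rankOne, orthonormal_iff_ite.1 basis.orthonormal]
  split_ifs
  · rw [one_smul]; rfl
  · rw [zero_smul]; rfl

theorem star_unit (i j : ℕ) : star (unit i j) = unit j i := by
  apply Subtype.ext
  change star (InnerProductSpace.rankOne ℂ (basis i) (basis j)) = _
  rw [ContinuousLinearMap.star_eq_adjoint, InnerProductSpace.adjoint_rankOne]
  rfl

theorem unit_ne_zero (i j : ℕ) : unit i j ≠ 0 := by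
  intro h
  have h' : InnerProductSpace.rankOne ℂ (basis i) (basis j) = 0 := congrArg Subtype.val h
  rw [InnerProductSpace.rankOne_eq_zero] at h'
  rcases h' with h' | h' <;> exact basis.orthonormal.ne_zero _ h'

/-- The sum is a coordinate projection applied to `x`, so this is Bessel's inequality. -/
theorem norm_sum_rankOne_apply_le {H : Type*} [NormedAddCommGroup H] [InnerProductSpace ℂ H]
    {b : ℕ → H} (hb : Orthonormal ℂ b) (s : Finset ℕ) (x : H) :
    ‖∑ i ∈ s, InnerProductSpace.rankOne ℂ (b i) (b i) x‖ ≤ ‖x‖ := by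
  refine le_of_sq_le_sq ?_ (norm_nonneg x)
  have h : ‖∑ i ∈ s, InnerProductSpace.rankOne ℂ (b i) (b i) x‖ ^ 2 =
      ∑ i ∈ s, ‖inner ℂ (b i) x‖ ^ 2 := by
    simp only [InnerProductSpace.rankOne_apply]
    have h' := hb.inner_sum (fun i => inner ℂ (b i) x) (fun i => inner ℂ (b i) x) s
    rw [inner_self_eq_norm_sq_to_K] at h'
    simp only [RCLike.conj_mul] at h'
    exact_mod_cast h'
  rw [h]
  exact hb.sum_inner_products_le x

/-- Compact operators are approximated by their compressions. -/
theorem exists_norm_sub_sum_rankOne_comp_le {T : lp (fun _ : ℕ => ℂ) 2 →L[ℂ] lp (fun _ : ℕ => ℂ) 2}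
    (hT : IsCompactOperator T) {ε : ℝ} (hε : 0 < ε) :
    ∃ s : Finset ℕ,
      ‖T - ∑ i ∈ s, InnerProductSpace.rankOne ℂ (basis i) (star T (basis i))‖ ≤ 3 * ε := by
  have hS := (IsCompactOperator.isCompact_closure_image_closedBall
    (f := (T : lp (fun _ : ℕ => ℂ) 2 →ₗ[ℂ] lp (fun _ : ℕ => ℂ) 2)) hT 1).totallyBounded.subset
      subset_closure
  obtain ⟨t, ht, hcov⟩ := Metric.totallyBounded_iff.1 hS ε hε
  have hlim : ∀ y : lp (fun _ : ℕ => ℂ) 2, ∀ᶠ s : Finset ℕ in atTop,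
      ‖(∑ i ∈ s, InnerProductSpace.rankOne ℂ (basis i) (basis i) y) - y‖ < ε := by
    intro y
    have := basis.hasSum_repr y
    simp only [HilbertBasis.repr_apply_apply] at this
    simpa [dist_eq_norm] using Metric.tendsto_nhds.1 this ε hε
  obtain ⟨s, hs⟩ := ((ht.eventually_all).2 fun y _ => hlim y).exists
  refine ⟨s, ContinuousLinearMap.opNorm_le_of_unit_norm (by positivity) fun x hx => ?_⟩
  obtain ⟨y, hy, hxy⟩ := Set.mem_iUnion₂.1 (hcov ⟨x, by simp [hx], rfl⟩)
  have hxy' : ‖T x - y‖ < ε := by simpa [dist_eq_norm] using hxy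
  -- With `P` the projection onto the coordinates in `s`, the sum is `P T`. On the unit sphere `T x`
  -- is near some `y` of a finite net, and `P` nearly fixes the whole net.
  have key : (T - ∑ i ∈ s, InnerProductSpace.rankOne ℂ (basis i) (star T (basis i))) x =
      (T x - y) - ((∑ i ∈ s, InnerProductSpace.rankOne ℂ (basis i) (basis i) y) - y)
        - ∑ i ∈ s, InnerProductSpace.rankOne ℂ (basis i) (basis i) (T x - y) := by
    simp only [sub_apply, sum_apply, map_sub, Finset.sum_sub_distrib,
      InnerProductSpace.rankOne_apply, ContinuousLinearMap.star_eq_adjoint,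
      ContinuousLinearMap.adjoint_inner_left]
    abel
  rw [key]
  calc _ ≤ ‖T x - y‖ + ‖(∑ i ∈ s, InnerProductSpace.rankOne ℂ (basis i) (basis i) y) - y‖ +
        ‖∑ i ∈ s, InnerProductSpace.rankOne ℂ (basis i) (basis i) (T x - y)‖ :=
        (norm_sub_le _ _).trans (add_le_add_left (norm_sub_le _ _) _)
    _ ≤ ε + ε + ε := by
        gcongr
        · exact (hs y hy).le
        · exact (norm_sum_rankOne_apply_le basis.orthonormal s _).trans hxy'.le
    _ = 3 * ε := by ring

/-- Two approximations: compact operators by finite sums of rank-one operators with first vector in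
the basis, then the second vector by combinations of basis vectors. -/
theorem closure_span_unit :
    (Submodule.span ℂ (Set.range fun p : ℕ × ℕ => unit p.1 p.2)).topologicalClosure = ⊤ := by
  set V := Submodule.span ℂ (Set.range fun p : ℕ × ℕ => unit p.1 p.2) with hV
  have hmem : ∀ i j, unit i j ∈ V := fun i j => Submodule.subset_span ⟨(i, j), rfl⟩
  let W : Submodule ℂ (lp (fun _ : ℕ => ℂ) 2 →L[ℂ] lp (fun _ : ℕ => ℂ) 2) :=
    V.map (compactOperators (lp (fun _ : ℕ => ℂ) 2)).toSubmodule.subtype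
  have h1 : ∀ i y, InnerProductSpace.rankOne ℂ (basis i) y ∈ W.topologicalClosure := by
    intro i y
    have hy : y ∈ (Submodule.span ℂ (Set.range basis)).topologicalClosure := by
      rw [basis.dense_span]; trivial
    refine map_mem_closure (InnerProductSpace.rankOne ℂ (basis i)).continuous hy fun z hz => ?_
    induction hz using Submodule.span_induction with
    | mem z hz =>
      obtain ⟨j, rfl⟩ := hz
      exact ⟨unit i j, hmem i j, rfl⟩
    | zero => rw [map_zero]; exact Submodule.zero_mem _
    | add z w _ _ hz hw => rw [map_add]; exact Submodule.add_mem _ hz hw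
    | smul c z _ hz => rw [map_smulₛₗ]; exact Submodule.smul_mem _ _ hz
  rw [eq_top_iff]
  rintro ⟨T, hT⟩ -
  have h2 : T ∈ closure (W.topologicalClosure : Set (lp (fun _ : ℕ => ℂ) 2 →L[ℂ] _)) := by
    refine Metric.mem_closure_iff.2 fun ε hε => ?_
    obtain ⟨s, hs⟩ := exists_norm_sub_sum_rankOne_comp_le hT (show 0 < ε / 6 by positivity)
    refine ⟨∑ i ∈ s, InnerProductSpace.rankOne ℂ (basis i) (star T (basis i)),
      Submodule.sum_mem _ fun i _ => h1 i _, ?_⟩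
    rw [dist_eq_norm]
    exact hs.trans_lt (by linarith)
  rw [W.isClosed_topologicalClosure.closure_eq] at h2
  change _ ∈ closure (V : Set StdCompacts)
  rw [Topology.IsInducing.subtypeVal.closure_eq_preimage_closure_image]
  exact h2

end StdCompacts

/-! ### Matricial systems and their norms on finite corners -/

/-- A matricial system of linear maps `κ i j : A → B`: the maps multiply like `a ↦ a ⊗ e i j` for a
system of matrix units `e`. -/
structure IsMatrixSystem {A B : Type*} [NonUnitalCStarAlgebra A] [NonUnitalCStarAlgebra B]
    (κ : ℕ → ℕ → A →ₗ[ℂ] B) : Prop where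
  mul_eq : ∀ i j k l a b, κ i j a * κ k l b = if j = k then κ i l (a * b) else 0
  star_eq : ∀ i j a, star (κ i j a) = κ j i (star a)

namespace IsMatrixSystem

variable {A B : Type*} [NonUnitalCStarAlgebra A] [NonUnitalCStarAlgebra B]
  {κ : ℕ → ℕ → A →ₗ[ℂ] B}

/-- The `*`-homomorphism on finite matrices given by a matricial system. -/
def hom (h : IsMatrixSystem κ) (N : ℕ) : CStarMatrix (Fin N) (Fin N) A →⋆ₙₐ[ℂ] B where
  toFun M := ∑ i : Fin N, ∑ j : Fin N, κ i j (M i j)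
  map_smul' c M := by simp [Finset.smul_sum]
  map_zero' := by simp
  map_add' M M' := by simp [Finset.sum_add_distrib]
  map_mul' M M' := by
    simp only [Finset.sum_mul_sum, h.mul_eq, CStarMatrix.mul_apply, map_sum, Fin.val_inj]
    refine Finset.sum_congr rfl fun i _ => ?_
    rw [Finset.sum_comm]
    refine Finset.sum_congr rfl fun j _ => ?_
    rw [Finset.sum_comm]
    simp
  map_star' M := by
    simp only [star_sum, h.star_eq, CStarMatrix.star_apply]
    rw [Finset.sum_comm]

theorem hom_apply (h : IsMatrixSystem κ) (N : ℕ) (M : CStarMatrix (Fin N) (Fin N) A) :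
    h.hom N M = ∑ i : Fin N, ∑ j : Fin N, κ i j (M i j) := rfl

/-- The diagonal maps `κ j j` are `*`-homomorphisms, hence contractive; the C⋆-identity reduces the
off-diagonal ones to these. -/
theorem norm_apply_le (h : IsMatrixSystem κ) (i j : ℕ) (a : A) : ‖κ i j a‖ ≤ ‖a‖ := by
  let φ : A →⋆ₙₐ[ℂ] B :=
    { toFun := κ j j
      map_smul' := by simp
      map_zero' := by simp
      map_add' := by simp
      map_mul' := fun a b => by simp [h.mul_eq]
      map_star' := fun a => by simp [h.star_eq] }
  have h1 : star (κ i j a) * κ i j a = φ (star a * a) := by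
    rw [h.star_eq, h.mul_eq, if_pos rfl]; rfl
  have h2 := NonUnitalStarAlgHom.norm_apply_le φ (star a * a)
  rw [← h1, CStarRing.norm_star_mul_self, CStarRing.norm_star_mul_self] at h2
  exact abs_le_of_sq_le_sq' (by simpa [pow_two] using h2) (norm_nonneg a) |>.2

/-- Compressing between `κ 0 i u` and `κ j 0 v` isolates `κ 0 0 (u * M i j * v)`, so injectivity of
the single map `κ 0 0` controls every entry. -/
theorem hom_injective (h : IsMatrixSystem κ) (h0 : Function.Injective (κ 0 0)) (N : ℕ) :
    Function.Injective (h.hom N) := by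
  rw [injective_iff_map_eq_zero]
  intro M hM
  ext i j
  have h1 : ∀ u v : A, u * M i j * v = 0 := fun u v => by
    apply h0
    have h2 : κ 0 i u * h.hom N M * κ j 0 v = 0 := by rw [hM]; simp
    rw [map_zero, ← h2, hom_apply]
    simp [Finset.mul_sum, Finset.sum_mul, h.mul_eq, Fin.val_inj]
  have h2 : ∀ u : A, u * M i j = 0 := fun u =>
    C0AlgebraStructure.eq_of_mul_left_eq fun v => by rw [h1, zero_mul]
  exact C0AlgebraStructure.eq_of_mul_right_eq fun u => by rw [h2]; simp

/-- The linear map on finitely supported families given by a matricial system. -/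
noncomputable def total (κ : ℕ → ℕ → A →ₗ[ℂ] B) : (ℕ × ℕ →₀ A) →ₗ[ℂ] B :=
  Finsupp.lsum ℂ fun p => κ p.1 p.2

theorem total_single (κ : ℕ → ℕ → A →ₗ[ℂ] B) (i j : ℕ) (a : A) :
    total κ (Finsupp.single (i, j) a) = κ i j a := by
  simp [total]

/-- The corner of a finitely supported family, as a finite matrix. -/
def corner (z : ℕ × ℕ →₀ A) (N : ℕ) : CStarMatrix (Fin N) (Fin N) A :=
  CStarMatrix.ofMatrix fun i j => z (i, j)

/-- Since this holds for all large `N`, finitely many families can be treated in one matrix algebra.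
-/
theorem eventually_total_eq (h : IsMatrixSystem κ) (z : ℕ × ℕ →₀ A) :
    ∀ᶠ N in atTop, total κ z = h.hom N (corner z N) := by
  have h1 : ∀ p : ℕ × ℕ, ∀ᶠ N in atTop, p ∈ Finset.range N ×ˢ Finset.range N := by
    intro p
    filter_upwards [eventually_gt_atTop p.1, eventually_gt_atTop p.2] with N h1 h2
    simp [h1, h2]
  filter_upwards [(eventually_all_finset z.support).2 fun p _ => h1 p] with N hN
  rw [hom_apply, total, Finsupp.lsum_apply, Finsupp.sum_of_support_subset z hN _ (by simp),
    Finset.sum_product, Finset.sum_range]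
  refine Finset.sum_congr rfl fun i _ => ?_
  rw [Finset.sum_range]
  rfl

open scoped ComplexOrder in
-- By the C⋆-identity a bound with constant `R` improves to one with `√R`. Starting from the crude
-- entrywise constant and iterating, the constant tends to `1`.
theorem norm_hom_map_smul_le (h : IsMatrixSystem κ) (N : ℕ) (C : CStarMatrix (Fin N) (Fin N) ℂ)
    (a : A) : ‖h.hom N (C.map fun c => c • a)‖ ≤ ‖C‖ * ‖a‖ := by
  have step : ∀ R : ℝ, 0 ≤ R → (∀ (C : CStarMatrix (Fin N) (Fin N) ℂ) (a : A),
      ‖h.hom N (C.map fun c => c • a)‖ ≤ R * (‖C‖ * ‖a‖)) →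
      ∀ (C : CStarMatrix (Fin N) (Fin N) ℂ) (a : A),
        ‖h.hom N (C.map fun c => c • a)‖ ≤ √R * (‖C‖ * ‖a‖) := by
    intro R hR hC C a
    have h1 : star (C.map fun c => c • a) * (C.map fun c => c • a) =
        (star C * C).map fun c => c • (star a * a) := by
      ext i j
      simp [CStarMatrix.mul_apply, CStarMatrix.star_apply, Finset.sum_smul, smul_mul_smul_comm]
    refine abs_le_of_sq_le_sq' ?_ (by positivity) |>.2
    rw [pow_two, ← CStarRing.norm_star_mul_self, ← map_star, ← map_mul, h1]
    refine (hC _ _).trans (le_of_eq ?_)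
    have h2 : ‖star C * C‖ = ‖C‖ * ‖C‖ := CStarRing.norm_star_mul_self
    rw [CStarRing.norm_star_mul_self, h2, mul_pow, Real.sq_sqrt hR]
    ring
  have base : ∀ (C : CStarMatrix (Fin N) (Fin N) ℂ) (a : A),
      ‖h.hom N (C.map fun c => c • a)‖ ≤ ((N : ℝ) * N) * (‖C‖ * ‖a‖) := by
    intro C a
    rw [hom_apply]
    calc _ ≤ ∑ i : Fin N, ∑ j : Fin N, ‖C‖ * ‖a‖ := by
          refine norm_sum_le_of_le _ fun i _ => norm_sum_le_of_le _ fun j _ => ?_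
          refine (h.norm_apply_le _ _ _).trans ?_
          rw [CStarMatrix.map_apply, norm_smul]
          gcongr
          exact CStarMatrix.norm_entry_le_norm
      _ = _ := by simp; ring
  -- The `+ 1` keeps the base positive when `N = 0`, so that its iterated square roots tend to `1`.
  have iter : ∀ k : ℕ, ∀ (C : CStarMatrix (Fin N) (Fin N) ℂ) (a : A),
      ‖h.hom N (C.map fun c => c • a)‖ ≤ (Real.sqrt^[k] ((N : ℝ) * N + 1)) * (‖C‖ * ‖a‖) := by
    have hpos : ∀ k : ℕ, 0 ≤ Real.sqrt^[k] ((N : ℝ) * N + 1) := by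
      intro k
      cases k with
      | zero => simp; positivity
      | succ k => rw [Function.iterate_succ_apply']; exact Real.sqrt_nonneg _
    intro k
    induction k with
    | zero => exact fun C a => (base C a).trans (by simp; gcongr; linarith)
    | succ k ih =>
      rw [Function.iterate_succ_apply']
      exact step _ (hpos k) ih
  have hlim : Tendsto (fun k : ℕ => Real.sqrt^[k] ((N : ℝ) * N + 1)) atTop (𝓝 1) := by
    have : ∀ k : ℕ, Real.sqrt^[k] ((N : ℝ) * N + 1) = ((N : ℝ) * N + 1) ^ ((1 / 2 : ℝ) ^ k) := by
      intro k
      induction k with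
      | zero => simp
      | succ k ih =>
        rw [Function.iterate_succ_apply', ih, Real.sqrt_eq_rpow, ← Real.rpow_mul (by positivity),
          pow_succ]
    simp only [this]
    have h0 : Tendsto (fun k : ℕ => (1 / 2 : ℝ) ^ k) atTop (𝓝 0) :=
      tendsto_pow_atTop_nhds_zero_of_lt_one (by norm_num) (by norm_num)
    simpa using tendsto_const_nhds.rpow h0 (Or.inl (by positivity : (N : ℝ) * N + 1 ≠ 0))
  simpa using le_of_tendsto' (tendsto_const_nhds (x := ‖h.hom N (C.map fun c => c • a)‖)
    |>.sub (hlim.mul_const (‖C‖ * ‖a‖))) (b := 0) fun k => sub_nonpos.2 (iter k C a)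

end IsMatrixSystem

/-- Semilinearity is allowed so that the involution is covered too. -/
theorem StdCompacts.clm_ext {σ : ℂ →+* ℂ} {F : Type*} [AddCommGroup F] [Module ℂ F]
    [TopologicalSpace F] [T2Space F] {f g : StdCompacts →SL[σ] F}
    (h : ∀ i j, f (unit i j) = g (unit i j)) : f = g := by
  refine ContinuousLinearMap.ext_on ?_ ?_ (s := Set.range fun p : ℕ × ℕ => unit p.1 p.2)
  · exact (Submodule.dense_iff_topologicalClosure_eq_top).2 closure_span_unit
  · rintro _ ⟨p, rfl⟩
    exact h _ _

/-- The matricial system of the compact operators. -/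
noncomputable def StdCompacts.system (i j : ℕ) : ℂ →ₗ[ℂ] StdCompacts :=
  LinearMap.toSpanSingleton ℂ _ (unit i j)

theorem StdCompacts.isMatrixSystem_system : IsMatrixSystem StdCompacts.system where
  mul_eq i j k l a b := by
    simp [StdCompacts.system, smul_mul_smul_comm, unit_mul_unit]
  star_eq i j a := by
    simp [StdCompacts.system, star_unit]

theorem StdCompacts.denseRange_total : DenseRange (IsMatrixSystem.total StdCompacts.system) := by
  have h := (Submodule.dense_iff_topologicalClosure_eq_top).2 closure_span_unit
  refine h.mono ?_
  change _ ≤ LinearMap.range (IsMatrixSystem.total StdCompacts.system)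
  rw [Submodule.span_le]
  rintro _ ⟨p, rfl⟩
  exact ⟨Finsupp.single (p.1, p.2) 1, by
    rw [IsMatrixSystem.total_single]; simp [StdCompacts.system]⟩

/-! ### Elementary tensors in the C⋆-tensor product -/

namespace CStarTensor

variable {A B : Type*} [NonUnitalCStarAlgebra A] [NonUnitalCStarAlgebra B]

/-- The elementary tensor `a ⊗ b` in the C⋆-tensor product. -/
noncomputable def tmul (a : A) (b : B) : CStarTensor A B :=
  PreCStarAlgebra.CStarCompletion.of (T := AlgTensor A B) (a ⊗ₜ[ℂ] b : A ⊗[ℂ] B)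

theorem norm_tmul_le (a : A) (b : B) : ‖tmul a b‖ ≤ ‖a‖ * ‖b‖ := by
  refine (PreCStarAlgebra.CStarCompletion.norm_of _).trans_le ?_
  exact (isCStarTensorSeminorm_maxSeminorm A B).tmul_le a b

theorem tmul_mul_tmul (a a' : A) (b b' : B) :
    tmul a b * tmul a' b' = tmul (a * a') (b * b') := by
  refine (PreCStarAlgebra.CStarCompletion.of_mul (T := AlgTensor A B) _ _).symm.trans ?_
  exact congrArg (PreCStarAlgebra.CStarCompletion.of (T := AlgTensor A B))
    (Algebra.TensorProduct.tmul_mul_tmul a a' b b')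

theorem star_tmul (a : A) (b : B) : star (tmul a b) = tmul (star a) (star b) := by
  refine (PreCStarAlgebra.CStarCompletion.of_star (T := AlgTensor A B) _).symm.trans ?_
  exact congrArg (PreCStarAlgebra.CStarCompletion.of (T := AlgTensor A B))
    (TensorProduct.star_tmul a b)

/-- The elementary tensor as a continuous bilinear map. -/
noncomputable def tmulL : A →L[ℂ] B →L[ℂ] CStarTensor A B :=
  LinearMap.mkContinuous₂ (LinearMap.mk₂ ℂ tmul
    (fun a a' b => by
      refine Eq.trans ?_ (PreCStarAlgebra.CStarCompletion.of_add (T := AlgTensor A B) _ _)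
      exact congrArg (PreCStarAlgebra.CStarCompletion.of (T := AlgTensor A B))
        (TensorProduct.add_tmul a a' b))
    (fun c a b => by
      refine Eq.trans ?_ (PreCStarAlgebra.CStarCompletion.of_smul (T := AlgTensor A B) _ _)
      rfl)
    (fun a b b' => by
      refine Eq.trans ?_ (PreCStarAlgebra.CStarCompletion.of_add (T := AlgTensor A B) _ _)
      exact congrArg (PreCStarAlgebra.CStarCompletion.of (T := AlgTensor A B))
        (TensorProduct.tmul_add a b b'))
    (fun c a b => by
      refine Eq.trans ?_ (PreCStarAlgebra.CStarCompletion.of_smul (T := AlgTensor A B) _ _)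
      exact congrArg (PreCStarAlgebra.CStarCompletion.of (T := AlgTensor A B))
        (TensorProduct.tmul_smul c a b))) 1
    (fun a b => by simpa using norm_tmul_le a b)

theorem tmulL_apply (a : A) (b : B) : tmulL a b = tmul a b := rfl

/-- The elementary tensors span a dense subspace. -/
theorem closure_eq_top {V : Submodule ℂ (CStarTensor A B)} (hV : IsClosed (V : Set (CStarTensor A B)))
    (h : ∀ a b, tmul a b ∈ V) : V = ⊤ := by
  rw [eq_top_iff]
  rintro z -
  refine PreCStarAlgebra.CStarCompletion.induction₁ (T := AlgTensor A B) (p := fun z => z ∈ V) z hV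
    fun z => ?_
  induction z using TensorProduct.induction_on with
  | zero => exact V.zero_mem
  | tmul a b => exact h a b
  | add x y hx hy =>
    exact (PreCStarAlgebra.CStarCompletion.of_add (T := AlgTensor A B) x y).symm ▸ V.add_mem hx hy

/-- The matricial system `a ↦ a ⊗ e i j`. -/
noncomputable def system (A : Type*) [NonUnitalCStarAlgebra A] (i j : ℕ) :
    A →ₗ[ℂ] CStarTensor A StdCompacts :=
  (tmulL.flip (StdCompacts.unit i j)).toLinearMap

theorem system_apply (i j : ℕ) (a : A) : system A i j a = tmul a (StdCompacts.unit i j) := rfl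

theorem isMatrixSystem_system : IsMatrixSystem (system A) where
  mul_eq i j k l a b := by
    rw [system_apply, system_apply, tmul_mul_tmul, StdCompacts.unit_mul_unit]
    split_ifs
    · rfl
    · rw [← tmulL_apply, map_zero]
  star_eq i j a := by
    rw [system_apply, star_tmul, StdCompacts.star_unit]; rfl

theorem denseRange_total_system : DenseRange (IsMatrixSystem.total (system A)) := by
  have h : (LinearMap.range (IsMatrixSystem.total (system A))).topologicalClosure = ⊤ := by
    refine closure_eq_top (Submodule.isClosed_topologicalClosure _) fun a T => ?_
    have hT : T ∈ (Submodule.span ℂ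
        (Set.range fun p : ℕ × ℕ => StdCompacts.unit p.1 p.2)).topologicalClosure := by
      rw [StdCompacts.closure_span_unit]; trivial
    refine map_mem_closure (tmulL a).continuous hT fun S hS => ?_
    have hle : Submodule.span ℂ (Set.range fun p : ℕ × ℕ => StdCompacts.unit p.1 p.2) ≤
        (LinearMap.range (IsMatrixSystem.total (system A))).comap (tmulL a).toLinearMap := by
      rw [Submodule.span_le]
      rintro _ ⟨⟨i, j⟩, rfl⟩
      exact ⟨Finsupp.single (i, j) a, IsMatrixSystem.total_single _ i j a⟩
    exact hle hS
  exact (Submodule.dense_iff_topologicalClosure_eq_top).2 h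

end CStarTensor

namespace TensorProduct

variable {A B C : Type*} [NonUnitalCStarAlgebra A] [NonUnitalCStarAlgebra B]
  [NonUnitalCStarAlgebra C]

theorem lift_mul_of_mul (f : A →ₗ[ℂ] B →ₗ[ℂ] C)
    (hf : ∀ a a' b b', f (a * a') (b * b') = f a b * f a' b') (x y : A ⊗[ℂ] B) :
    lift f (x * y) = lift f x * lift f y := by
  induction x using TensorProduct.induction_on with
  | zero => simp
  | add x x' hx hx' => rw [add_mul, map_add, map_add, add_mul, hx, hx']
  | tmul a b =>
    induction y using TensorProduct.induction_on with
    | zero => simp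
    | add y y' hy hy' => rw [mul_add, map_add, map_add, mul_add, hy, hy']
    | tmul a' b' => rw [Algebra.TensorProduct.tmul_mul_tmul, lift.tmul, lift.tmul, lift.tmul, hf]

theorem lift_star_of_star (f : A →ₗ[ℂ] B →ₗ[ℂ] C)
    (hf : ∀ a b, f (star a) (star b) = star (f a b)) (x : A ⊗[ℂ] B) :
    lift f (star x) = star (lift f x) := by
  induction x using TensorProduct.induction_on with
  | zero => simp
  | add x x' hx hx' => rw [star_add, map_add, map_add, star_add, hx, hx']
  | tmul a b => rw [TensorProduct.star_tmul, lift.tmul, lift.tmul, hf]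

end TensorProduct

/-! ### Matricial systems as representations of the stabilization -/

namespace IsMatrixSystem

variable {A B : Type*} [NonUnitalCStarAlgebra A] [NonUnitalCStarAlgebra B]
  {κ : ℕ → ℕ → A →ₗ[ℂ] B}

/-- Scalar matrices embed isometrically in `𝒦`, so the matrix norm of a corner is an operator norm.
The resulting bound, uniform in the size, lets the pairing extend to all compact operators. -/
theorem norm_total_smul_le (h : IsMatrixSystem κ) (c : ℕ × ℕ →₀ ℂ) (a : A) :
    ‖c.sum fun p r => r • κ p.1 p.2 a‖ ≤ ‖total StdCompacts.system c‖ * ‖a‖ := by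
  open scoped ComplexOrder in
  obtain ⟨N, h1, h2⟩ := ((StdCompacts.isMatrixSystem_system.eventually_total_eq c).and
    (h.eventually_total_eq (c.mapRange (fun r => r • a) (zero_smul ℂ a)))).exists
  have h3 : (c.sum fun p r => r • κ p.1 p.2 a) =
      total κ (c.mapRange (fun r => r • a) (zero_smul ℂ a)) := by
    rw [total, Finsupp.lsum_apply, Finsupp.sum_mapRange_index (by simp)]
    simp
  have h4 : corner (c.mapRange (fun r => r • a) (zero_smul ℂ a)) N =
      (corner c N).map fun r => r • a := rfl
  have h5 : ‖StdCompacts.isMatrixSystem_system.hom N (corner c N)‖ = ‖corner c N‖ :=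
    NonUnitalStarAlgHom.norm_map _ (StdCompacts.isMatrixSystem_system.hom_injective
      (fun r s hrs => by
        simpa [StdCompacts.system, StdCompacts.unit_ne_zero] using hrs) N) _
  rw [h3, h2, h4, h1, h5]
  exact h.norm_hom_map_smul_le N _ a

/-- The map `(T, a) ↦ ∑ T i j • κ i j a`, for a compact operator `T`. -/
noncomputable def pairing (h : IsMatrixSystem κ) : StdCompacts →L[ℂ] A →L[ℂ] B :=
  LinearMap.extendOfNorm
    (Finsupp.lsum ℂ fun p : ℕ × ℕ => LinearMap.toSpanSingleton ℂ (A →L[ℂ] B)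
      ((κ p.1 p.2).mkContinuous 1 fun a => by simpa using h.norm_apply_le p.1 p.2 a))
    (total StdCompacts.system)

theorem pairing_unit (h : IsMatrixSystem κ) (i j : ℕ) (a : A) :
    h.pairing (StdCompacts.unit i j) a = κ i j a := by
  have h1 : StdCompacts.unit i j = total StdCompacts.system (Finsupp.single (i, j) 1) := by
    rw [total_single]; simp [StdCompacts.system]
  rw [h1, pairing, LinearMap.extendOfNorm_eq StdCompacts.denseRange_total]
  · simp
  · refine ⟨1, fun c => ContinuousLinearMap.opNorm_le_bound _ (by positivity) fun a => ?_⟩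
    rw [one_mul]
    refine le_trans (le_of_eq ?_) (h.norm_total_smul_le c a)
    simp [Finsupp.sum]

theorem norm_pairing_le (h : IsMatrixSystem κ) (T : StdCompacts) : ‖h.pairing T‖ ≤ ‖T‖ := by
  refine (LinearMap.norm_extendOfNorm_apply_le StdCompacts.denseRange_total 1 (fun c => ?_) T).trans
    (one_mul _).le
  rw [one_mul]
  refine ContinuousLinearMap.opNorm_le_bound _ (by positivity) fun a => ?_
  refine le_trans (le_of_eq ?_) (h.norm_total_smul_le c a)
  simp [Finsupp.sum]

/-- Both sides are continuous and linear in `S` and `T`, so matrix units suffice, one variable at a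
time. -/
theorem pairing_mul (h : IsMatrixSystem κ) (S T : StdCompacts) (a b : A) :
    h.pairing S a * h.pairing T b = h.pairing (S * T) (a * b) := by
  have h1 : ∀ i j, (ContinuousLinearMap.mul ℂ B (κ i j a)).comp (h.pairing.flip b) =
      (h.pairing.flip (a * b)).comp
        (ContinuousLinearMap.mul ℂ StdCompacts (StdCompacts.unit i j)) := by
    refine fun i j => StdCompacts.clm_ext fun k l => ?_
    simp only [ContinuousLinearMap.comp_apply, ContinuousLinearMap.flip_apply,
      ContinuousLinearMap.mul_apply', pairing_unit, StdCompacts.unit_mul_unit, h.mul_eq]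
    split_ifs <;> simp [pairing_unit]
  have h2 : ((ContinuousLinearMap.mul ℂ B).flip (h.pairing T b)).comp (h.pairing.flip a) =
      (h.pairing.flip (a * b)).comp ((ContinuousLinearMap.mul ℂ StdCompacts).flip T) := by
    refine StdCompacts.clm_ext fun i j => ?_
    simpa [pairing_unit] using DFunLike.congr_fun (h1 i j) T
  simpa using DFunLike.congr_fun h2 S

theorem star_pairing (h : IsMatrixSystem κ) (T : StdCompacts) (a : A) :
    star (h.pairing T a) = h.pairing (star T) (star a) := by
  have h1 : ((starL ℂ : B ≃L⋆[ℂ] B) : B →L⋆[ℂ] B).comp (h.pairing.flip a) =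
      (h.pairing.flip (star a)).comp
        ((starL ℂ : StdCompacts ≃L⋆[ℂ] StdCompacts) : StdCompacts →L⋆[ℂ] StdCompacts) := by
    refine StdCompacts.clm_ext fun i j => ?_
    simp [pairing_unit, StdCompacts.star_unit, h.star_eq]
  simpa using DFunLike.congr_fun h1 T

/-- The map `a ⊗ T ↦ ∑ T i j • κ i j a` on the algebraic tensor product. -/
noncomputable def lift (h : IsMatrixSystem κ) : A ⊗[ℂ] StdCompacts →ₗ[ℂ] B :=
  TensorProduct.lift (ContinuousLinearMap.toLinearMap₁₂ h.pairing.flip)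

theorem lift_tmul (h : IsMatrixSystem κ) (a : A) (T : StdCompacts) :
    h.lift (a ⊗ₜ T) = h.pairing T a := rfl

theorem lift_mul (h : IsMatrixSystem κ) (x y : A ⊗[ℂ] StdCompacts) :
    h.lift (x * y) = h.lift x * h.lift y :=
  TensorProduct.lift_mul_of_mul _ (fun a b S T => (h.pairing_mul S T a b).symm) x y

theorem lift_star (h : IsMatrixSystem κ) (x : A ⊗[ℂ] StdCompacts) :
    h.lift (star x) = star (h.lift x) :=
  TensorProduct.lift_star_of_star _ (fun a S => (h.star_pairing S a).symm) x

/-- The norm of `B` pulls back to a C⋆-seminorm, which the maximal one dominates. Contractivity of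
the pairing supplies the bound on elementary tensors. -/
theorem norm_lift_le (h : IsMatrixSystem κ) (x : A ⊗[ℂ] StdCompacts) :
    ‖h.lift x‖ ≤ CStarTensor.maxSeminorm A StdCompacts x := by
  refine CStarTensor.le_maxSeminorm A StdCompacts ((normSeminorm ℂ B).comp h.lift) ?_ x
  refine ⟨fun x y => ?_, fun x => ?_, fun a T => ?_⟩
  · simpa [lift_mul] using norm_mul_le _ _
  · simpa [lift_mul, lift_star] using CStarRing.norm_star_mul_self
  · simp only [Seminorm.comp_apply, coe_normSeminorm, lift_tmul]
    refine ((h.pairing T).le_opNorm a).trans ?_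
    rw [mul_comm]
    gcongr
    exact h.norm_pairing_le T

theorem norm_total_le (h : IsMatrixSystem κ) (z : ℕ × ℕ →₀ A) :
    ‖total κ z‖ ≤ ‖total (CStarTensor.system A) z‖ := by
  let w : A ⊗[ℂ] StdCompacts := z.sum fun p a => a ⊗ₜ StdCompacts.unit p.1 p.2
  have h1 : total κ z = h.lift w := by
    simp [w, total, Finsupp.sum, lift_tmul, pairing_unit]
  have h2 : total (CStarTensor.system A) z =
      PreCStarAlgebra.CStarCompletion.of (T := CStarTensor.AlgTensor A StdCompacts) w := by
    let e : CStarTensor.AlgTensor A StdCompacts →+ CStarTensor A StdCompacts :=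
      { toFun := PreCStarAlgebra.CStarCompletion.of
        map_zero' := PreCStarAlgebra.CStarCompletion.of_zero
        map_add' := PreCStarAlgebra.CStarCompletion.of_add }
    exact (map_sum e _ z.support).symm
  rw [h1, h2]
  have h3 : ‖h.lift w‖ ≤ ‖(show CStarTensor.AlgTensor A StdCompacts from w)‖ := h.norm_lift_le w
  exact h3.trans_eq (PreCStarAlgebra.CStarCompletion.norm_of _).symm

/-- For the reverse inequality, a corner of matrices over `A` sits isometrically in `B` by
injectivity, while its map to `A ⊗ 𝒦` is contractive. -/
theorem norm_total_eq (h : IsMatrixSystem κ) (h0 : Function.Injective (κ 0 0)) (z : ℕ × ℕ →₀ A) :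
    ‖total κ z‖ = ‖total (CStarTensor.system A) z‖ := by
  refine le_antisymm (h.norm_total_le z) ?_
  let _ : PartialOrder A := CStarAlgebra.spectralOrder A
  have _ : StarOrderedRing A := CStarAlgebra.spectralOrderedRing A
  obtain ⟨N, h1, h2⟩ := ((h.eventually_total_eq z).and
    (CStarTensor.isMatrixSystem_system.eventually_total_eq z)).exists
  rw [h1, h2, NonUnitalStarAlgHom.norm_map _ (h.hom_injective h0 N)]
  exact NonUnitalStarAlgHom.norm_apply_le _ _

/-- Matricial systems with equal norms and dense ranges have isomorphic codomains. -/
theorem nonempty_equiv_of_norm_eq {C : Type*} [NonUnitalCStarAlgebra C]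
    {κ' : ℕ → ℕ → A →ₗ[ℂ] C} (h : IsMatrixSystem κ) (h' : IsMatrixSystem κ')
    (hd : DenseRange (total κ)) (hd' : DenseRange (total κ'))
    (hn : ∀ z, ‖total κ' z‖ = ‖total κ z‖) : Nonempty (B ≃⋆ₐ[ℂ] C) := by
  obtain ⟨U, hU⟩ : ∃ U : B ≃ₗᵢ[ℂ] C, ∀ i j a, U (κ i j a) = κ' i j a := by
    refine ⟨(LinearEquiv.refl ℂ (ℕ × ℕ →₀ A)).extendOfIsometry (total κ) (total κ') hd hd' hn,
      fun i j a => ?_⟩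
    rw [← total_single, ← total_single]
    exact LinearEquiv.extendOfIsometry_eq (LinearEquiv.refl ℂ (ℕ × ℕ →₀ A)) (total κ)
      (total κ') hd hd' hn _
  -- `U` intertwines the `*`-homomorphisms on each corner, so it respects products and adjoints on a
  -- dense set.
  have hUN : ∀ N M, U (h.hom N M) = h'.hom N M := fun N M => by
    simp only [hom_apply, map_sum, hU]
  have hmul : ∀ x y, U (x * y) = U x * U y := by
    refine fun x y => isClosed_property2 hd (p := fun x y => U (x * y) = U x * U y)
      (isClosed_eq (by fun_prop) (by fun_prop)) (fun z w => ?_) x y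
    obtain ⟨N, h1, h2⟩ := ((h.eventually_total_eq z).and (h.eventually_total_eq w)).exists
    rw [h1, h2, hUN, hUN, ← map_mul, hUN, map_mul]
  have hstar : ∀ x, U (star x) = star (U x) := by
    refine fun x => isClosed_property hd (p := fun x => U (star x) = star (U x))
      (isClosed_eq (by fun_prop) (by fun_prop)) (fun z => ?_) x
    obtain ⟨N, h1⟩ := (h.eventually_total_eq z).exists
    rw [h1, hUN, ← map_star, hUN, map_star]
  exact ⟨{ U.toLinearEquiv with
    map_mul' := hmul
    map_star' := hstar
    map_smul' := map_smul U }⟩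

/-- A C⋆-algebra with an injective matricial system with dense span is a stabilization. -/
theorem nonempty_equiv (h : IsMatrixSystem κ) (h0 : Function.Injective (κ 0 0))
    (hd : DenseRange (total κ)) : Nonempty (B ≃⋆ₐ[ℂ] CStarTensor A StdCompacts) :=
  h.nonempty_equiv_of_norm_eq CStarTensor.isMatrixSystem_system hd
    CStarTensor.denseRange_total_system fun z => (h.norm_total_eq h0 z).symm

end IsMatrixSystem

/-! ### Approximately orthogonal copies, and their existence in stable algebras -/

/-- Every `star a * a` is approximately of the form `star x * x` with `x` approximately
orthogonal to a prescribed finite set. For separable algebras this is equivalent to stability. -/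
def HasOrthogonalCopies (A : Type*) [NonUnitalCStarAlgebra A] : Prop :=
  ∀ (a : A) (F : Finset A) (ε : ℝ), 0 < ε →
    ∃ x : A, ‖star x * x - star a * a‖ < ε ∧ ∀ b ∈ F, ‖b * x‖ < ε

namespace HasOrthogonalCopies

variable {A B : Type*} [NonUnitalCStarAlgebra A] [NonUnitalCStarAlgebra B]

/-- The data lift, and the witness is pushed forward without loss because `*`-homomorphisms are
contractive. This is how stability reaches the fibres. -/
theorem of_surjective (h : HasOrthogonalCopies A) (φ : A →⋆ₙₐ[ℂ] B) (hφ : Function.Surjective φ) :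
    HasOrthogonalCopies B := by
  classical
  intro a F ε hε
  obtain ⟨a, rfl⟩ := hφ a
  obtain ⟨x, hx, hF⟩ := h a (F.image (Function.surjInv hφ)) ε hε
  refine ⟨φ x, ?_, fun b hb => ?_⟩
  · rw [← map_star, ← map_star, ← map_mul, ← map_mul, ← map_sub]
    exact (NonUnitalStarAlgHom.norm_apply_le φ _).trans_lt hx
  · have := hF _ (Finset.mem_image_of_mem _ hb)
    rw [← Function.surjInv_eq hφ b, ← map_mul]
    exact (NonUnitalStarAlgHom.norm_apply_le φ _).trans_lt this

end HasOrthogonalCopies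

namespace CStarQuotient

variable {A : Type*} [NonUnitalCStarAlgebra A] (J : Submodule ℂ A) [IsClosedStarIdeal J]

/-- The quotient map as a `*`-homomorphism. -/
noncomputable def mkHom : A →⋆ₙₐ[ℂ] CStarQuotient J where
  toFun := mk J
  map_smul' := map_smul (mk J)
  map_zero' := map_zero (mk J)
  map_add' := map_add (mk J)
  map_mul' := mk_mul J
  map_star' := mk_star J

end CStarQuotient

namespace IsMatrixSystem

variable {A B : Type*} [NonUnitalCStarAlgebra A] [NonUnitalCStarAlgebra B]
  {κ : ℕ → ℕ → A →ₗ[ℂ] B}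

/-- The image of a finite matrix, with the rows shifted by its size. -/
def shifted (κ : ℕ → ℕ → A →ₗ[ℂ] B) (N : ℕ) (M : CStarMatrix (Fin N) (Fin N) A) : B :=
  ∑ i : Fin N, ∑ j : Fin N, κ (N + i) j (M i j)

theorem star_shifted_mul_shifted (h : IsMatrixSystem κ) (N : ℕ)
    (M : CStarMatrix (Fin N) (Fin N) A) :
    star (shifted κ N M) * shifted κ N M = star (h.hom N M) * h.hom N M := by
  simp only [shifted, hom_apply, star_sum, Finset.sum_mul, Finset.mul_sum, h.star_eq, h.mul_eq,
    Nat.add_left_cancel_iff]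

theorem hom_mul_shifted (h : IsMatrixSystem κ) (N : ℕ) (M M' : CStarMatrix (Fin N) (Fin N) A) :
    h.hom N M * shifted κ N M' = 0 := by
  simp only [shifted, hom_apply, Finset.sum_mul, Finset.mul_sum, h.mul_eq]
  refine Finset.sum_eq_zero fun i _ => Finset.sum_eq_zero fun j _ => Finset.sum_eq_zero fun k _ =>
    Finset.sum_eq_zero fun l _ => if_neg ?_
  have := l.2
  omega

/-- Approximate `a` and `F` in one `N × N` corner, then move the rows of the matrix of `a` down by
`N`. This leaves `star x * x` unchanged and makes `x` vanish under left multiplication by the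
corner. -/
theorem hasOrthogonalCopies (h : IsMatrixSystem κ) (hd : DenseRange (total κ)) :
    HasOrthogonalCopies B := by
  intro a F ε hε
  obtain ⟨z, hz1, hz2⟩ : ∃ z, ‖star (total κ z) * total κ z - star a * a‖ < ε ∧
      ‖total κ z‖ < ‖a‖ + 1 := by
    refine hd.exists_mem_open (s := {b | ‖star b * b - star a * a‖ < ε ∧ ‖b‖ < ‖a‖ + 1}) ?_
      ⟨a, by simpa using hε, by simp⟩
    have h1 : Continuous fun b : B => ‖star b * b - star a * a‖ := by fun_prop
    exact (isOpen_lt h1 continuous_const).inter (isOpen_lt continuous_norm continuous_const)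
  have hδ : 0 < ε / (‖a‖ + 1) := by positivity
  have hF : ∀ b : B, ∃ w, ‖b - total κ w‖ < ε / (‖a‖ + 1) := fun b => by
    simpa [dist_eq_norm] using hd.exists_dist_lt b hδ
  choose w hw using hF
  obtain ⟨N, hN, hNF⟩ := ((h.eventually_total_eq z).and
    ((eventually_all_finset F).2 fun b _ => h.eventually_total_eq (w b))).exists
  rw [hN] at hz1 hz2
  have hnorm : ‖shifted κ N (corner z N)‖ = ‖h.hom N (corner z N)‖ := by
    have := congrArg norm (h.star_shifted_mul_shifted N (corner z N))
    rw [CStarRing.norm_star_mul_self, CStarRing.norm_star_mul_self] at this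
    exact (mul_self_inj (norm_nonneg _) (norm_nonneg _)).1 this
  refine ⟨shifted κ N (corner z N), ?_, fun b hb => ?_⟩
  · rwa [star_shifted_mul_shifted]
  · have h1 : b * shifted κ N (corner z N) = (b - total κ (w b)) * shifted κ N (corner z N) := by
      rw [sub_mul, hNF b hb, hom_mul_shifted, sub_zero]
    rw [h1]
    calc _ ≤ ‖b - total κ (w b)‖ * ‖shifted κ N (corner z N)‖ := norm_mul_le _ _
      _ ≤ ‖b - total κ (w b)‖ * (‖a‖ + 1) := by rw [hnorm]; gcongr
      _ < ε / (‖a‖ + 1) * (‖a‖ + 1) := by gcongr; exact hw b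
      _ = ε := by field_simp

end IsMatrixSystem

theorem IsStable.hasOrthogonalCopies {A : Type*} [NonUnitalCStarAlgebra A] (h : IsStable A) :
    HasOrthogonalCopies A := by
  obtain ⟨e⟩ := h
  have h1 : HasOrthogonalCopies (CStarTensor A StdCompacts) :=
    CStarTensor.isMatrixSystem_system.hasOrthogonalCopies CStarTensor.denseRange_total_system
  exact h1.of_surjective (e.symm : CStarTensor A StdCompacts →⋆ₙₐ[ℂ] A) e.symm.surjective

/-- The approximate unit is written as `star e * e` so that an orthogonal copy of `e` can replace
it. -/
theorem exists_norm_star_mul_self_mul_sub_lt {A : Type*} [NonUnitalCStarAlgebra A] (c : A) {ε : ℝ}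
    (hε : 0 < ε) : ∃ e : A, ‖star e * e‖ ≤ 1 ∧ ‖star e * e * c - c‖ < ε := by
  let _ : PartialOrder A := CStarAlgebra.spectralOrder A
  have _ : StarOrderedRing A := CStarAlgebra.spectralOrderedRing A
  have hu := CStarAlgebra.increasingApproximateUnit A
  have _ := hu.neBot
  obtain ⟨u, hu1, hu2, hu3⟩ := ((Metric.tendsto_nhds.1 (hu.tendsto_mul_right c) ε hε).and
    (hu.eventually_nonneg.and hu.eventually_norm)).exists
  obtain ⟨e, rfl⟩ := CStarAlgebra.nonneg_iff_eq_star_mul_self.1 hu2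
  exact ⟨e, hu3, by simpa [dist_eq_norm] using hu1⟩

/-! ### Generic sequences by Baire category -/

/-- The space `ℓ¹(A)` of absolutely summable sequences. -/
abbrev SummableSeq (A : Type*) [NormedAddCommGroup A] : Type _ := lp (fun _ : ℕ => A) 1

namespace SummableSeq

variable {A : Type*} [NonUnitalCStarAlgebra A]

theorem summable_norm (t : SummableSeq A) : Summable fun n => ‖t n‖ := by
  simpa using t.2.summable (by simp)

theorem norm_eq (t : SummableSeq A) : ‖t‖ = ∑' n, ‖t n‖ := by
  rw [lp.norm_eq_tsum_rpow (by simp)]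
  simp

/-- The sequence `n ↦ star (t n) * a`. -/
def adj (t : SummableSeq A) (a : A) : SummableSeq A :=
  ⟨fun n => star (t n) * a, memℓp_gen (by
    simp only [ENNReal.toReal_one, Real.rpow_one]
    exact (t.summable_norm.mul_right ‖a‖).of_nonneg_of_le (fun _ => norm_nonneg _)
      fun n => by simpa using norm_mul_le (star (t n)) a)⟩

theorem adj_apply (t : SummableSeq A) (a : A) (n : ℕ) : t.adj a n = star (t n) * a := rfl

theorem norm_adj_le (t : SummableSeq A) (a : A) : ‖t.adj a‖ ≤ ‖t‖ * ‖a‖ := by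
  rw [norm_eq, norm_eq, ← tsum_mul_right]
  exact Summable.tsum_le_tsum (fun n => by simpa [adj_apply] using norm_mul_le (star (t n)) a)
    (summable_norm _) (t.summable_norm.mul_right _)

theorem adj_add_left (s t : SummableSeq A) (a : A) : (s + t).adj a = s.adj a + t.adj a := by
  ext n; simp [adj_apply, add_mul]

theorem adj_sub_left (s t : SummableSeq A) (a : A) : (s - t).adj a = s.adj a - t.adj a := by
  ext n; simp [adj_apply, sub_mul]

/-- The bounded linear map `a ↦ (n ↦ star (t n) * a)`. -/
noncomputable def adjL (t : SummableSeq A) : A →L[ℂ] SummableSeq A :=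
  LinearMap.mkContinuous
    { toFun := t.adj
      map_add' := fun a b => by ext n; simp [adj_apply, mul_add]
      map_smul' := fun c a => by ext n; simp [adj_apply, mul_smul_comm] } ‖t‖ t.norm_adj_le

theorem adjL_apply (t : SummableSeq A) (a : A) : t.adjL a = t.adj a := rfl

theorem continuous_adj (a : A) : Continuous fun t : SummableSeq A => t.adj a := by
  refine LipschitzWith.continuous (K := ‖a‖₊) (LipschitzWith.of_dist_le_mul fun s t => ?_)
  rw [dist_eq_norm, dist_eq_norm, ← adj_sub_left, mul_comm]
  exact norm_adj_le _ _

theorem continuous_apply (n : ℕ) : Continuous fun t : SummableSeq A => t n :=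
  (lp.lipschitzWith_one_eval 1 n).continuous

theorem adj_single (n : ℕ) (x a : A) :
    adj (lp.single 1 n x) a = lp.single 1 n (star x * a) := by
  ext k
  rw [adj_apply]
  obtain rfl | h := eq_or_ne k n
  · rw [lp.single_apply_self, lp.single_apply_self]
  · rw [lp.single_apply_ne _ _ _ h, lp.single_apply_ne _ _ _ h]; simp

/-- The truncation of a sequence. -/
noncomputable def trunc (t : SummableSeq A) (N : ℕ) : SummableSeq A :=
  ∑ n ∈ Finset.range N, lp.single 1 n (t n)

theorem tendsto_trunc (t : SummableSeq A) : Tendsto t.trunc atTop (𝓝 t) :=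
  (lp.hasSum_single (by simp) t).tendsto_sum_nat

theorem trunc_apply_self (t : SummableSeq A) (N : ℕ) : t.trunc N N = 0 := by
  rw [trunc, lp.coeFn_sum, Finset.sum_apply]
  refine Finset.sum_eq_zero fun n hn => ?_
  exact lp.single_apply_ne _ _ _ (by simp at hn; omega)

theorem adj_trunc (t : SummableSeq A) (N : ℕ) (a : A) :
    (t.trunc N).adj a = ∑ n ∈ Finset.range N, lp.single 1 n (star (t n) * a) := by
  let f : SummableSeq A →+ SummableSeq A := 
    { toFun := fun t => t.adj a
      map_zero' := by ext n; simp [adj_apply]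
      map_add' := fun s t => adj_add_left s t a }
  refine (map_sum f _ _).trans (Finset.sum_congr rfl fun n _ => adj_single n _ a)

/-- After truncation at `N` the entry `N` is free. A small multiple `δ` of an approximate unit
placed there is undone by the factor `δ⁻¹` in `a`. -/
theorem dense_setOf_exists_norm_mul_sub_lt (c : A) {ρ : ℝ} (hρ : 0 < ρ) :
    Dense {t : SummableSeq A | ∃ n a, ‖t n * a - c‖ < ρ} := by
  refine Metric.dense_iff.2 fun t ε hε => ?_
  obtain ⟨N, hN⟩ := (Metric.tendsto_nhds.1 t.tendsto_trunc (ε / 2) (by positivity)).exists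
  obtain ⟨e, he1, he2⟩ := exists_norm_star_mul_self_mul_sub_lt c hρ
  -- Truncation costs less than `ε / 2` and the new entry at most `δ`.
  set δ : ℝ := ε / 3 with hδ
  have hδ0 : 0 < δ := by positivity
  refine ⟨t.trunc N + lp.single 1 N ((δ : ℂ) • (star e * e)), ?_, N, (δ : ℂ)⁻¹ • c, ?_⟩
  · rw [Metric.mem_ball]
    refine (dist_triangle _ (t.trunc N) _).trans_lt ?_
    have h1 : dist (t.trunc N + lp.single 1 N ((δ : ℂ) • (star e * e))) (t.trunc N) ≤ δ := by
      rw [dist_eq_norm, add_sub_cancel_left, lp.norm_single (by simp), norm_smul,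
        Complex.norm_real, Real.norm_of_nonneg hδ0.le]
      exact mul_le_of_le_one_right hδ0.le he1
    linarith
  · have h1 : (t.trunc N + lp.single 1 N ((δ : ℂ) • (star e * e)) : SummableSeq A) N =
        (δ : ℂ) • (star e * e) := by
      rw [lp.coeFn_add, Pi.add_apply, trunc_apply_self, lp.single_apply_self, zero_add]
    have h2 : (δ : ℂ) ≠ 0 := by exact_mod_cast hδ0.ne'
    rw [h1, smul_mul_smul_comm, mul_inv_cancel₀ h2, one_smul]
    exact he2

/-- Add `δ • x` to entry `m` of a truncation, with `x` a copy of an approximate unit `e` orthogonal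
to the old entries. For `a = δ⁻¹ • (x * c)` the old entries contribute almost nothing, and the new
one gives `star x * x * c`, close to `c`. -/
theorem dense_setOf_exists_norm_adj_sub_lt (hA : HasOrthogonalCopies A) (m : ℕ) (c : A) {ρ : ℝ}
    (hρ : 0 < ρ) :
    Dense {t : SummableSeq A | ∃ a, ‖t.adj a - lp.single 1 m c‖ < ρ} := by
  classical
  refine Metric.dense_iff.2 fun t ε hε => ?_
  obtain ⟨N, hN⟩ := (Metric.tendsto_nhds.1 t.tendsto_trunc (ε / 2) (by positivity)).exists
  obtain ⟨e, he1, he2⟩ := exists_norm_star_mul_self_mul_sub_lt c (show 0 < ρ / 3 by positivity)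
  -- Here `‖x‖ ≤ 2`, so the perturbation costs at most `2 * δ` besides the `ε / 2` for truncation.
  set δ : ℝ := ε / 5 with hδ
  have hδ0 : 0 < δ := by positivity
  have hδ1 : (δ : ℂ) ≠ 0 := by exact_mod_cast hδ0.ne'
  -- The tolerance `ρ / (3 * K)` is charged `N` times with factor `δ⁻¹ * ‖c‖` and once with factor
  -- `‖c‖`; this `K` keeps the total within `ρ / 3`.
  set K : ℝ := (N * δ⁻¹ + 1) * (‖c‖ + 1) with hK
  have hK0 : 0 < K := by positivity
  obtain ⟨x, hx1, hx2⟩ := hA e ((Finset.range N).image fun n => star (t n)) (min 1 (ρ / (3 * K)))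
    (by positivity)
  have hxn : ‖x‖ ≤ 2 := by
    have h1 : ‖star x * x‖ ≤ 2 := by
      calc ‖star x * x‖ = ‖(star x * x - star e * e) + star e * e‖ := by rw [sub_add_cancel]
        _ ≤ 1 + 1 := (norm_add_le _ _).trans (add_le_add (hx1.le.trans (min_le_left _ _)) he1)
        _ = 2 := by norm_num
    rw [CStarRing.norm_star_mul_self] at h1
    nlinarith [norm_nonneg x]
  refine ⟨t.trunc N + lp.single 1 m ((δ : ℂ) • x), ?_, (δ : ℂ)⁻¹ • (x * c), ?_⟩
  · rw [Metric.mem_ball]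
    refine (dist_triangle _ (t.trunc N) _).trans_lt ?_
    have h1 : dist (t.trunc N + lp.single 1 m ((δ : ℂ) • x)) (t.trunc N) ≤ δ * 2 := by
      rw [dist_eq_norm, add_sub_cancel_left, lp.norm_single (by simp), norm_smul,
        Complex.norm_real, Real.norm_of_nonneg hδ0.le]
      gcongr
    linarith
  · have h1 : star ((δ : ℂ) • x) * ((δ : ℂ)⁻¹ • (x * c)) = star x * x * c := by
      rw [star_smul, smul_mul_smul_comm, ← mul_assoc]
      simp [hδ1]
    rw [adj_add_left, adj_trunc, adj_single, h1, add_sub_assoc, ← lp.single_sub]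
    have h2 : ∀ n ∈ Finset.range N,
        ‖(lp.single 1 n (star (t n) * ((δ : ℂ)⁻¹ • (x * c))) : SummableSeq A)‖ ≤
          δ⁻¹ * (ρ / (3 * K) * ‖c‖) := by
      intro n hn
      rw [lp.norm_single (by simp), mul_smul_comm, norm_smul, norm_inv, Complex.norm_real,
        Real.norm_of_nonneg hδ0.le, ← mul_assoc]
      gcongr
      refine (norm_mul_le _ _).trans ?_
      gcongr
      exact (hx2 _ (Finset.mem_image_of_mem _ hn)).le.trans (min_le_right _ _)
    have h3 : ‖star x * x * c - c‖ < ρ / (3 * K) * ‖c‖ + ρ / 3 := by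
      calc ‖star x * x * c - c‖ = ‖(star x * x - star e * e) * c + (star e * e * c - c)‖ := by
            congr 1; noncomm_ring
        _ ≤ ‖star x * x - star e * e‖ * ‖c‖ + ‖star e * e * c - c‖ :=
            (norm_add_le _ _).trans (add_le_add_left (norm_mul_le _ _) _)
        _ < ρ / (3 * K) * ‖c‖ + ρ / 3 :=
            add_lt_add_of_le_of_lt (by gcongr; exact hx1.le.trans (min_le_right _ _)) he2
    calc _ ≤ N * (δ⁻¹ * (ρ / (3 * K) * ‖c‖)) + ‖star x * x * c - c‖ := by
          refine (norm_add_le _ _).trans (add_le_add ?_ (lp.norm_single (by simp) _ _).le)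
          refine (norm_sum_le_of_le _ h2).trans ?_
          simp
      _ < N * (δ⁻¹ * (ρ / (3 * K) * ‖c‖)) + (ρ / (3 * K) * ‖c‖ + ρ / 3) := by gcongr
      _ = ρ / 3 * ((N * δ⁻¹ + 1) * ‖c‖ / K) + ρ / 3 := by field_simp; ring
      _ ≤ ρ / 3 * 1 + ρ / 3 := by
          gcongr
          rw [div_le_one hK0, hK]
          gcongr
          linarith
      _ ≤ ρ := by linarith

/-- A generic sequence generates the algebra and has an adjoint with dense range. -/
theorem exists_dense_range_adjL [TopologicalSpace.SeparableSpace A] (hA : HasOrthogonalCopies A) :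
    ∃ t : SummableSeq A, DenseRange (fun p : ℕ × A => t p.1 * p.2) ∧ DenseRange t.adjL := by
  let d := TopologicalSpace.denseSeq A
  have hpos : ∀ j : ℕ, (0 : ℝ) < 1 / (j + 1) := fun j => by positivity
  -- The targets run through a dense sequence and the tolerances through `1 / (j + 1)`, so the
  -- conditions are countably many. Each is open, as a fixed witness survives small changes of `t`.
  have h1 : ∀ᶠ t in residual (SummableSeq A), ∀ k j : ℕ, ∃ n a, ‖t n * a - d k‖ < 1 / (j + 1) := by
    simp only [eventually_countable_forall]
    refine fun k j => residual_of_dense_open ?_ (dense_setOf_exists_norm_mul_sub_lt _ (hpos j))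
    simp only [Set.ofPred_exists]
    exact isOpen_iUnion fun n => isOpen_iUnion fun a =>
      isOpen_lt ((((continuous_apply n).mul continuous_const).sub continuous_const).norm)
        continuous_const
  have h2 : ∀ᶠ t in residual (SummableSeq A), ∀ m k j : ℕ,
      ∃ a, ‖t.adj a - lp.single 1 m (d k)‖ < 1 / (j + 1) := by
    simp only [eventually_countable_forall]
    refine fun m k j => residual_of_dense_open ?_ (dense_setOf_exists_norm_adj_sub_lt hA _ _ (hpos j))
    simp only [Set.ofPred_exists]
    exact isOpen_iUnion fun a => isOpen_lt (((continuous_adj a).sub continuous_const).norm)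
        continuous_const
  obtain ⟨t, ht1, ht2⟩ := (dense_of_mem_residual (h1.and h2)).nonempty
  refine ⟨t, ?_, ?_⟩
  · refine dense_closure.1 ((TopologicalSpace.denseRange_denseSeq A).mono ?_)
    rintro _ ⟨k, rfl⟩
    refine Metric.mem_closure_iff.2 fun ε hε => ?_
    obtain ⟨j, hj⟩ := exists_nat_one_div_lt hε
    obtain ⟨n, a, hna⟩ := ht1 k j
    exact ⟨_, ⟨(n, a), rfl⟩, by rw [dist_comm, dist_eq_norm]; exact hna.trans hj⟩
  · set V := (LinearMap.range t.adjL.toLinearMap).topologicalClosure with hV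
    have hsingle : ∀ m c, (lp.single 1 m c : SummableSeq A) ∈ V := by
      intro m c
      have hc : c ∈ closure (Set.range d) := TopologicalSpace.denseRange_denseSeq A c
      have h3 := map_mem_closure (t := (V : Set (SummableSeq A)))
        (lp.isometry_single (E := fun _ : ℕ => A) (p := 1) m).continuous hc ?_
      · rwa [(Submodule.isClosed_topologicalClosure _).closure_eq] at h3
      rintro _ ⟨k, rfl⟩
      refine Metric.mem_closure_iff.2 fun ε hε => ?_
      obtain ⟨j, hj⟩ := exists_nat_one_div_lt hε
      obtain ⟨a, ha⟩ := ht2 m k j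
      exact ⟨_, ⟨a, rfl⟩, by rw [dist_comm, dist_eq_norm]; exact ha.trans hj⟩
    have hall : ∀ s : SummableSeq A, s ∈ V := fun s =>
      (Submodule.isClosed_topologicalClosure _).mem_of_tendsto s.tendsto_trunc
        (Eventually.of_forall fun N => Submodule.sum_mem _ fun n _ => hsingle n _)
    exact hall

end SummableSeq

/-! ### Polar decomposition of a generic sequence -/

namespace SummableSeq

variable {A : Type*} [NonUnitalCStarAlgebra A]

theorem norm_apply_le (t : SummableSeq A) (n : ℕ) : ‖t n‖ ≤ ‖t‖ := by
  rw [norm_eq]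
  exact t.summable_norm.le_tsum n fun _ _ => norm_nonneg _

theorem summable_norm_mul (t s : SummableSeq A) : Summable fun n => ‖t n * s n‖ :=
  (s.summable_norm.mul_left ‖t‖).of_nonneg_of_le (fun _ => norm_nonneg _)
    fun n => (norm_mul_le _ _).trans (by gcongr; exact t.norm_apply_le n)

/-- The bounded linear map `s ↦ ∑' n, t n * s n`. -/
noncomputable def dotL (t : SummableSeq A) : SummableSeq A →L[ℂ] A :=
  LinearMap.mkContinuous
    { toFun := fun s => ∑' n, t n * s n
      map_add' := fun a b => by
        rw [← (t.summable_norm_mul a).of_norm.tsum_add (t.summable_norm_mul b).of_norm]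
        simp [mul_add]
      map_smul' := fun c a => by
        rw [RingHom.id_apply, ← (t.summable_norm_mul a).of_norm.tsum_const_smul]
        simp [mul_smul_comm] } ‖t‖ fun s => by
    have h : ∀ n, ‖t n * s n‖ ≤ ‖t‖ * ‖s n‖ := fun n =>
      (norm_mul_le _ _).trans (by gcongr; exact t.norm_apply_le n)
    rw [norm_eq s, ← tsum_mul_left]
    exact (norm_tsum_le_tsum_norm (t.summable_norm_mul s)).trans
      (Summable.tsum_le_tsum h (t.summable_norm_mul s) (s.summable_norm.mul_left _))

theorem dotL_apply (t s : SummableSeq A) : t.dotL s = ∑' n, t n * s n := rfl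

theorem dotL_single (t : SummableSeq A) (n : ℕ) (a : A) : t.dotL (lp.single 1 n a) = t n * a := by
  rw [dotL_apply, tsum_eq_single n, lp.single_apply_self]
  intro k hk
  rw [lp.single_apply_ne _ _ _ hk, mul_zero]

/-- The left side is the norm of the square sum of the entries of `t.adj c`: the `ℓ²`-norm is at
most the `ℓ¹`-norm. -/
theorem norm_star_mul_dotL_adj_le (t : SummableSeq A) (c : A) :
    ‖star c * t.dotL (t.adj c)‖ ≤ ‖t.adj c‖ * ‖t.adj c‖ := by
  have h : ∀ n, ‖star c * (t n * t.adj c n)‖ ≤ ‖t.adj c‖ * ‖t.adj c n‖ := fun n => by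
    have : star c * (t n * t.adj c n) = star (t.adj c n) * t.adj c n := by
      simp [adj_apply, mul_assoc]
    rw [this, CStarRing.norm_star_mul_self]
    gcongr
    exact (t.adj c).norm_apply_le n
  have hs := ((t.adj c).summable_norm.mul_left ‖t.adj c‖)
  have hs' := hs.of_nonneg_of_le (fun _ => norm_nonneg _) h
  rw [dotL_apply, ← (t.summable_norm_mul (t.adj c)).of_norm.tsum_mul_left]
  calc _ ≤ ∑' n, ‖star c * (t n * t.adj c n)‖ := norm_tsum_le_tsum_norm hs'
    _ ≤ ∑' n, ‖t.adj c‖ * ‖t.adj c n‖ := Summable.tsum_le_tsum h hs' hs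
    _ = _ := by rw [tsum_mul_left, ← norm_eq]

/-- This `q` is the modulus of `T = t.adjL`, namely the square root of `∑ t n * star (t n)`. -/
theorem exists_sqrt (t : SummableSeq A) :
    ∃ q : A, star q = q ∧ ∀ c, q * (q * c) = t.dotL (t.adj c) := by
  let _ : PartialOrder A := CStarAlgebra.spectralOrder A
  have _ : StarOrderedRing A := CStarAlgebra.spectralOrderedRing A
  have hs : Summable fun n => t n * star (t n) := by
    refine Summable.of_norm ((t.summable_norm.mul_left ‖t‖).of_nonneg_of_le
      (fun _ => norm_nonneg _) fun n => ?_)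
    rw [CStarRing.norm_self_mul_star]
    gcongr
    exact t.norm_apply_le n
  have h0 : 0 ≤ ∑' n, t n * star (t n) := tsum_nonneg fun n => mul_star_self_nonneg _
  refine ⟨CFC.sqrt (∑' n, t n * star (t n)), (CFC.sqrt_nonneg _).isSelfAdjoint.star_eq, fun c => ?_⟩
  rw [← mul_assoc, CFC.sqrt_mul_sqrt_self _ h0, dotL_apply, ← hs.tsum_mul_right]
  simp [adj_apply, mul_assoc]

/-- Orthogonal isometric module maps whose ranges span the algebra, from a generic sequence. -/
theorem exists_isometries (t : SummableSeq A) (ht : DenseRange fun p : ℕ × A => t p.1 * p.2)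
    (ht' : DenseRange t.adjL) :
    ∃ s : ℕ → A →L[ℂ] A, (∀ i j a b, star (s i a) * s j b = if i = j then star a * b else 0) ∧
      ∀ V : Submodule ℂ A, IsClosed (V : Set A) → (∀ i a, s i a ∈ V) → V = ⊤ := by
  obtain ⟨q, hq, hqt⟩ := t.exists_sqrt
  have hbound : ∀ c, ‖ContinuousLinearMap.mul ℂ A q c‖ ≤ 1 * ‖t.adjL c‖ := by
    intro c
    rw [one_mul]
    refine abs_le_of_sq_le_sq' ?_ (norm_nonneg _) |>.2
    rw [pow_two, pow_two, ← CStarRing.norm_star_mul_self, ContinuousLinearMap.mul_apply', star_mul,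
      hq, mul_assoc, hqt]
    exact t.norm_star_mul_dotL_adj_le c
  -- By `hbound`, `T c ↦ q * c` is well defined and bounded on the dense range of `T`. Its extension
  -- `R` inverts the polar part of `T`.
  let R : SummableSeq A →L[ℂ] A := LinearMap.extendOfNorm
    (ContinuousLinearMap.mul ℂ A q).toLinearMap t.adjL.toLinearMap
  have hR : ∀ c, R (t.adj c) = q * c := fun c =>
    LinearMap.extendOfNorm_eq ht' ⟨1, hbound⟩ c
  have hqR : ∀ s, q * R s = t.dotL s := fun s =>
    isClosed_property ht' (p := fun s => q * R s = t.dotL s)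
      (isClosed_eq (by fun_prop) (by fun_prop)) (fun c => by rw [adjL_apply, hR, hqt]) s
  -- `R` preserves the inner product of sequences. For `s = T c` both sides equal `star c * t j *
  -- b`, because `q * R` is `t.dotL`.
  have hinner : ∀ s j b, star (R s) * R (lp.single 1 j b) = star (s j) * b := by
    intro s j b
    have hc : Continuous fun s : SummableSeq A => s j := continuous_apply j
    refine isClosed_property ht' (p := fun s => star (R s) * R (lp.single 1 j b) = star (s j) * b)
      (isClosed_eq (by fun_prop) ((continuous_star.comp hc).mul continuous_const)) (fun c => ?_) s
    rw [adjL_apply, hR, adj_apply, star_mul, hq, mul_assoc, hqR, dotL_single]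
    simp [mul_assoc]
  refine ⟨fun i => R.comp (lp.singleContinuousLinearMap ℂ (fun _ : ℕ => A) 1 i), ?_, ?_⟩
  · intro i j a b
    refine (hinner (lp.single 1 i a) j b).trans ?_
    split_ifs with h
    · rw [h, lp.single_apply_self]
    · rw [lp.single_apply_ne _ _ _ (Ne.symm h), star_zero, zero_mul]
  · intro V hV hs
    have h1 : ∀ s, R s ∈ V := fun s => by
      refine hV.mem_of_tendsto ((R.continuous.tendsto s).comp s.tendsto_trunc)
        (Eventually.of_forall fun N => ?_)
      simp only [Function.comp_apply, trunc, map_sum]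
      exact Submodule.sum_mem _ fun n _ => hs n _
    -- On the range of `T`, `t.dotL (t.adj c) = q * (q * c) = R (t.adj (q * c))`, so the range of
    -- `t.dotL`, and with it every `t n * a`, lies in `V`.
    have h2 : ∀ s, t.dotL s ∈ V := fun s =>
      isClosed_property ht' (p := fun s => t.dotL s ∈ V) (hV.preimage t.dotL.continuous)
        (fun c => by rw [adjL_apply, ← hqt, ← hR]; exact h1 _) s
    rw [eq_top_iff]
    rintro a -
    exact isClosed_property ht (p := fun a => a ∈ V) hV
      (fun p => by rw [← dotL_single]; exact h2 _) a

end SummableSeq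

/-! ### From orthogonal isometries to stability -/

theorem denseRange_mul_star (A : Type*) [NonUnitalCStarAlgebra A] :
    DenseRange fun p : A × A => p.1 * star p.2 := by
  intro a
  refine Metric.mem_closure_iff.2 fun ε hε => ?_
  obtain ⟨e, -, he⟩ := exists_norm_star_mul_self_mul_sub_lt a hε
  exact ⟨_, ⟨(star e * e, star a), rfl⟩, by simpa [dist_eq_norm, norm_sub_rev] using he⟩

/-- Formally the matrix units are `a ↦ s i * a * star (s j)`. The `s i` need not have adjoints, so
identities are checked on the dense set of products `b * star c`. -/
theorem isStable_of_isometries {A : Type*} [NonUnitalCStarAlgebra A] (s : ℕ → A →L[ℂ] A)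
    (hs : ∀ i j a b, star (s i a) * s j b = if i = j then star a * b else 0)
    (hd : ∀ V : Submodule ℂ A, IsClosed (V : Set A) → (∀ i a, s i a ∈ V) → V = ⊤) :
    IsStable A := by
  -- Maps preserving inner products are automatically module maps: the defect is orthogonal to the
  -- range of `s i`, hence to itself.
  have hmul : ∀ i a b, s i (a * b) = s i a * b := by
    intro i a b
    have h1 : ∀ x, star (s i x) * (s i (a * b) - s i a * b) = 0 := fun x => by
      rw [mul_sub, ← mul_assoc, hs, hs, if_pos rfl, if_pos rfl, mul_assoc, sub_self]
    rw [← sub_eq_zero, ← CStarRing.star_mul_self_eq_zero_iff]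
    nth_rw 1 [star_sub]
    rw [sub_mul, h1, star_mul, mul_assoc, h1, mul_zero, sub_zero]
  let κ : ℕ → ℕ → A →ₗ[ℂ] A := fun i j =>
    { toFun := fun a => s i (star (s j (star a)))
      map_add' := by simp
      map_smul' := by simp }
  have hκc : ∀ i j, Continuous (κ i j) := fun i j =>
    (s i).continuous.comp (continuous_star.comp ((s j).continuous.comp continuous_star))
  have hκ : ∀ i j b c, κ i j (b * star c) = s i b * star (s j c) := fun i j b c => by
    change s i (star (s j (star (b * star c)))) = _
    rw [star_mul, star_star, hmul, star_mul, star_star, hmul]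
  have hsys : IsMatrixSystem κ := by
    constructor
    · intro i j k l a b
      refine isClosed_property2 (denseRange_mul_star A)
        (p := fun a b => κ i j a * κ k l b = if j = k then κ i l (a * b) else 0) ?_ ?_ a b
      · have h1 := hκc i j
        have h2 := hκc k l
        have h3 := hκc i l
        refine isClosed_eq (by fun_prop) ?_
        split_ifs
        · fun_prop
        · fun_prop
      · rintro ⟨b, c⟩ ⟨d, e⟩
        have h1 : s i b * star (s j c) * (s k d * star (s l e)) =
            s i b * (star (s j c) * s k d) * star (s l e) := by simp only [mul_assoc]
        simp only [hκ, h1, hs]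
        split_ifs
        · rw [← hmul, ← hκ]
          simp only [mul_assoc]
        · simp
    · intro i j a
      refine isClosed_property (denseRange_mul_star A)
        (p := fun a => star (κ i j a) = κ j i (star a)) ?_ ?_ a
      · have h1 := hκc i j
        have h2 := hκc j i
        exact isClosed_eq (by fun_prop) (by fun_prop)
      · rintro ⟨b, c⟩
        simp only [hκ, star_mul, star_star]
  have hinj : ∀ i a, s i a = 0 → a = 0 := fun i a h => by
    have := hs i i a a
    rw [h, mul_zero, if_pos rfl] at this
    exact CStarRing.star_mul_self_eq_zero_iff _ |>.1 this.symm
  refine hsys.nonempty_equiv ((injective_iff_map_eq_zero _).2 fun a ha => ?_) ?_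
  · have h1 := hinj _ _ (star_eq_zero.1 (hinj _ _ ha))
    exact star_eq_zero.1 h1
  · set V := (LinearMap.range (IsMatrixSystem.total κ)).topologicalClosure with hV
    have hVc : IsClosed (V : Set A) := Submodule.isClosed_topologicalClosure _
    have h1 : ∀ i a j c, s i a * star (s j c) ∈ V := fun i a j c => subset_closure
      ⟨Finsupp.single (i, j) (a * star c), by rw [IsMatrixSystem.total_single, hκ]⟩
    -- The spanning hypothesis is applied to one factor at a time, through preimages of `V`.
    have h2 : ∀ x j c, x * star (s j c) ∈ V := fun x j c => by
      have := hd (V.comap ((ContinuousLinearMap.mul ℂ A).flip (star (s j c))).toLinearMap)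
        (hVc.preimage (ContinuousLinearMap.continuous _)) fun i a => h1 i a j c
      exact (this ▸ Submodule.mem_top : x ∈ V.comap _)
    have h3 : ∀ x y, x * star y ∈ V := fun x y => by
      have := hd (V.comap ((ContinuousLinearMap.mul ℂ A x).comp
        ((starL ℂ : A ≃L⋆[ℂ] A) : A →L⋆[ℂ] A)).toLinearMap)
        (hVc.preimage (ContinuousLinearMap.continuous _)) fun i a => h2 x i a
      exact (this ▸ Submodule.mem_top : y ∈ V.comap _)
    intro a
    exact isClosed_property (denseRange_mul_star A) (p := fun a => a ∈ V) hVc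
      (fun p => h3 p.1 p.2) a

/-- A separable C⋆-algebra with approximately orthogonal copies is stable. -/
theorem HasOrthogonalCopies.isStable {A : Type*} [NonUnitalCStarAlgebra A]
    [TopologicalSpace.SeparableSpace A] (h : HasOrthogonalCopies A) : IsStable A := by
  obtain ⟨t, ht, ht'⟩ := SummableSeq.exists_dense_range_adjL h
  obtain ⟨s, hs, hd⟩ := t.exists_isometries ht ht'
  exact isStable_of_isometries s hs hd

/-! ### Coloured partitions of unity -/

theorem IsOpen.exists_continuousMap_pos_iff {X : Type*} [TopologicalSpace X]
    [TopologicalSpace.MetrizableSpace X] {V : Set X} (hV : IsOpen V) :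
    ∃ φ : C(X, ℝ), ∀ x, 0 ≤ φ x ∧ (0 < φ x ↔ x ∈ V) := by
  let _ := TopologicalSpace.metrizableSpaceMetric X
  -- `Metric.infDist` to the empty set is `0`, so the whole space needs a constant function.
  rcases Vᶜ.eq_empty_or_nonempty with h | h
  · refine ⟨1, fun x => ⟨by simp, ?_⟩⟩
    rw [Set.compl_empty_iff] at h
    simp [h]
  · refine ⟨⟨fun x => Metric.infDist x Vᶜ, Metric.continuous_infDist_pt _⟩,
      fun x => ⟨Metric.infDist_nonneg, ?_⟩⟩
    have := hV.isClosed_compl.notMem_iff_infDist_pos h (x := x)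
    rw [Set.notMem_compl_iff] at this
    exact this.symm

section Peak

variable {X α : Type*} [TopologicalSpace X] [DecidableEq α] (φ : α → C(X, ℝ)) (F : Finset α)

/-- A function that is positive exactly where the `φ v`, `v ∈ s`, are positive and
larger than all other `φ w`, `w ∈ F`. -/
noncomputable def peak (s : Finset α) : C(X, ℝ) where
  toFun x := (∏ v ∈ s, φ v x) * ∏ v ∈ s, ∏ w ∈ F \ s, max (φ v x - φ w x) 0

variable {φ F}

theorem peak_nonneg (hφ : ∀ v x, 0 ≤ φ v x) (s : Finset α) (x : X) : 0 ≤ peak φ F s x :=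
  mul_nonneg (Finset.prod_nonneg fun v _ => hφ v x)
    (Finset.prod_nonneg fun _ _ => Finset.prod_nonneg fun _ _ => le_max_right _ _)

theorem pos_of_peak_ne_zero (hφ : ∀ v x, 0 ≤ φ v x) {s : Finset α} {x : X}
    (h : peak φ F s x ≠ 0) {v : α} (hv : v ∈ s) : 0 < φ v x :=
  (hφ v x).lt_of_ne' (Finset.prod_ne_zero_iff.1 (left_ne_zero_of_mul h) v hv)

theorem lt_of_peak_ne_zero {s : Finset α} {x : X} (h : peak φ F s x ≠ 0) {v w : α} (hv : v ∈ s)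
    (hw : w ∈ F \ s) : φ w x < φ v x := by
  have h1 := Finset.prod_ne_zero_iff.1 (Finset.prod_ne_zero_iff.1 (right_ne_zero_of_mul h) v hv) w hw
  by_contra h2
  exact h1 (max_eq_right (by linarith))

/-- Two distinct sets of equal size each have an element outside the other, so both peaks being
nonzero forces contradictory strict inequalities. As in barycentric subdivision, cardinality serves
as the colour. -/
theorem peak_mul_peak {s t : Finset α} (hs : s ⊆ F) (ht : t ⊆ F) (hst : s ≠ t)
    (hc : s.card = t.card) (x : X) : peak φ F s x * peak φ F t x = 0 := by
  by_contra h
  have h1 := left_ne_zero_of_mul h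
  have h2 := right_ne_zero_of_mul h
  obtain ⟨v, hv, hv'⟩ : ∃ v ∈ s, v ∉ t := by
    by_contra! h3
    exact hst (Finset.eq_of_subset_of_card_le h3 hc.ge)
  obtain ⟨w, hw, hw'⟩ : ∃ w ∈ t, w ∉ s := by
    by_contra! h3
    exact hst (Finset.eq_of_subset_of_card_le h3 hc.le).symm
  exact lt_asymm (lt_of_peak_ne_zero h1 hv (Finset.mem_sdiff.2 ⟨ht hw, hw'⟩))
    (lt_of_peak_ne_zero h2 hw (Finset.mem_sdiff.2 ⟨hs hv, hv'⟩))

/-- The set of all maximisers at `x` works. -/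
theorem exists_peak_pos {x : X} (h : ∃ v ∈ F, 0 < φ v x) :
    ∃ s ∈ F.powerset, s.Nonempty ∧ 0 < peak φ F s x := by
  obtain ⟨v₀, hv₀, hpos⟩ := h
  obtain ⟨m, hm, hmax⟩ := F.exists_max_image (fun v => φ v x) ⟨v₀, hv₀⟩
  refine ⟨F.filter fun v => φ v x = φ m x, Finset.mem_powerset.2 (Finset.filter_subset _ _),
    ⟨m, Finset.mem_filter.2 ⟨hm, rfl⟩⟩, mul_pos ?_ ?_⟩
  · refine Finset.prod_pos fun v hv => ?_
    rw [(Finset.mem_filter.1 hv).2]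
    exact hpos.trans_le (hmax _ hv₀)
  · refine Finset.prod_pos fun v hv => Finset.prod_pos fun w hw => ?_
    rw [Finset.mem_sdiff, Finset.mem_filter, not_and] at hw
    have h1 := hmax w hw.1
    have h2 := hw.2 hw.1
    rw [(Finset.mem_filter.1 hv).2]
    exact lt_max_of_lt_left (sub_pos.2 (lt_of_le_of_ne h1 h2))

end Peak

/-- In covering dimension at most `n`, a family of neighbourhoods of the points of a compact set
has a subordinate finite family of functions, coloured by `n + 1` colours, such that the functions
of one colour are orthogonal and the squares form a partition of unity on the compact set. -/
theorem CoveringDimLE.exists_coloured_partition {X : Type*} [TopologicalSpace X]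
    [TopologicalSpace.MetrizableSpace X] {n : ℕ} (hX : CoveringDimLE X n) {K : Set X}
    (hK : IsCompact K) (U : X → Set X) (hU : ∀ x ∈ K, U x ∈ 𝓝 x) :
    ∃ (m : ℕ) (k : Fin m → C(X, ℝ)) (pt : Fin m → X) (col : Fin m → ℕ),
      (∀ j, pt j ∈ K ∧ col j ≤ n) ∧ (∀ j x, 0 ≤ k j x) ∧ (∀ x, ∑ j, k j x ^ 2 ≤ 1) ∧
      (∀ x ∈ K, ∑ j, k j x ^ 2 = 1) ∧ (∀ j x, x ∉ U (pt j) → k j x = 0) ∧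
      ∀ i j, i ≠ j → col i = col j → ∀ x, k i x * k j x = 0 := by
  classical
  obtain ⟨t, ht, hcov⟩ := hK.elim_nhds_subcover (fun x => interior (U x))
    fun x hx => interior_mem_nhds.2 (hU x hx)
  obtain ⟨𝒱, h𝒱f, h𝒱o, h𝒱c, h𝒱r, h𝒱n⟩ := hX
    (insert Kᶜ ((fun x => interior (U x)) '' (t : Set X))) ((t.finite_toSet.image _).insert _)
    (by
      rintro V (rfl | ⟨x, -, rfl⟩)
      · exact hK.isClosed.isOpen_compl
      · exact isOpen_interior)
    (by
      rw [Set.sUnion_insert, Set.sUnion_image, ← Set.univ_subset_iff, ← Set.compl_union_self K]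
      exact Set.union_subset_union_right _ hcov)
  choose! φ' hφ' using fun V (hV : V ∈ 𝒱) => (h𝒱o V hV).exists_continuousMap_pos_iff
  let φ : 𝒱 → C(X, ℝ) := fun V => φ' V
  have hφ : ∀ v x, 0 ≤ φ v x := fun v x => (hφ' v v.2 x).1
  have hφ0 : ∀ v x, 0 < φ v x ↔ x ∈ v.1 := fun v x => (hφ' v v.2 x).2
  have _ : Fintype 𝒱 := h𝒱f.fintype
  let P : Finset (Finset 𝒱) := Finset.univ.filter Finset.Nonempty
  let ψ : Finset 𝒱 → C(X, ℝ) := peak φ Finset.univ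
  have hψ0 : ∀ s x, 0 ≤ ψ s x := fun s x => peak_nonneg hφ s x
  have hΘ : ∀ x, 0 < ∑ s ∈ P, ψ s x := by
    intro x
    have hx : x ∈ ⋃₀ 𝒱 := by rw [h𝒱c]; trivial
    obtain ⟨V, hV, hxV⟩ := hx
    obtain ⟨s, -, hs, hpos⟩ := exists_peak_pos (φ := φ) (F := Finset.univ)
      ⟨⟨V, hV⟩, Finset.mem_univ _, (hφ0 ⟨V, hV⟩ x).2 hxV⟩
    exact Finset.sum_pos' (fun s _ => hψ0 s x)
      ⟨s, Finset.mem_filter.2 ⟨Finset.mem_univ _, hs⟩, hpos⟩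
  -- A nonzero peak at `x` puts `x` in every member of `s`, and the refinement has order at most `n
  -- + 1`.
  have hcard : ∀ s x, ψ s x ≠ 0 → s.card ≤ n + 1 := by
    intro s x hs
    have h1 : (s.map (Function.Embedding.subtype _) : Set (Set X)) ⊆ {V | V ∈ 𝒱 ∧ x ∈ V} := by
      intro V hV
      obtain ⟨v, hv, rfl⟩ := Finset.mem_map.1 (Finset.mem_coe.1 hV)
      exact ⟨v.2, (hφ0 v x).1 (pos_of_peak_ne_zero hφ hs hv)⟩
    have h2 := (Set.encard_le_encard h1).trans (h𝒱n x)
    rw [Set.encard_coe_eq_coe_finsetCard, Finset.card_map] at h2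
    exact_mod_cast h2
  -- Sets in `P` outside `Q` contribute nothing on `K`: a nonempty set with a nonzero peak there is
  -- small, and its members meet `K`, so they refine some `U x` and not `Kᶜ`.
  let Q : Finset (Finset 𝒱) := P.filter fun s => s.card ≤ n + 1 ∧ ∃ v ∈ s, ∃ x ∈ t, v.1 ⊆ U x
  have hQ : ∀ s : Q, ∃ x ∈ t, ∃ v ∈ s.1, v.1 ⊆ U x := fun s => by
    obtain ⟨-, v, hv, x, hx, hvx⟩ := (Finset.mem_filter.1 s.2).2
    exact ⟨x, hx, v, hv, hvx⟩
  choose pt hpt hptv using hQ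
  let k : Q → C(X, ℝ) := fun s =>
    ⟨fun x => √(ψ s x / ∑ s ∈ P, ψ s x), Continuous.sqrt (Continuous.div (ψ s).continuous
      (by fun_prop) fun x => (hΘ x).ne')⟩
  have hk : ∀ s x, k s x = √(ψ s x / ∑ s ∈ P, ψ s x) := fun _ _ => rfl
  have hkψ : ∀ s x, k s x ≠ 0 → ψ s x ≠ 0 := fun s x h h' => h (by rw [hk, h']; simp)
  have hk2 : ∀ s x, k s x ^ 2 = ψ s x / ∑ s ∈ P, ψ s x := fun s x => by
    rw [hk, Real.sq_sqrt (div_nonneg (hψ0 _ _) (hΘ x).le)]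
  have hsum : ∀ x, ∑ s : Q, k s x ^ 2 = (∑ s ∈ Q, ψ s x) / ∑ s ∈ P, ψ s x := fun x => by
    simp only [hk2]
    rw [Finset.sum_div, ← Finset.sum_coe_sort Q]
  let e := Q.equivFin.symm
  -- Sizes `1, …, n + 1` become colours `0, …, n`; truncated subtraction is harmless since the sets
  -- are nonempty.
  refine ⟨Q.card, fun j => k (e j), fun j => pt (e j), fun j => (e j).1.card - 1,
    fun j => ⟨ht _ (hpt _), ?_⟩, fun j x => Real.sqrt_nonneg _, fun x => ?_, fun x hx => ?_,
    fun j x hx => ?_, fun i j hij hc x => ?_⟩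
  · have := (Finset.mem_filter.1 (e j).2).2.1
    exact Nat.sub_le_iff_le_add.2 this
  · rw [e.sum_comp fun s => k s x ^ 2, hsum, div_le_one (hΘ x)]
    exact Finset.sum_le_sum_of_subset_of_nonneg (Finset.filter_subset _ _) fun s _ _ => hψ0 s x
  · rw [e.sum_comp fun s => k s x ^ 2, hsum, div_eq_one_iff_eq (hΘ x).ne']
    refine Finset.sum_subset (Finset.filter_subset _ _) fun s hsP hsQ => ?_
    by_contra hne
    refine hsQ (Finset.mem_filter.2 ⟨hsP, hcard s x hne, ?_⟩)
    obtain ⟨v, hv⟩ := (Finset.mem_filter.1 hsP).2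
    have hxv := (hφ0 v x).1 (pos_of_peak_ne_zero hφ hne hv)
    obtain ⟨W, hW, hvW⟩ := h𝒱r v v.2
    rcases hW with rfl | ⟨y, hy, rfl⟩
    · exact absurd hx (hvW hxv)
    · exact ⟨v, hv, y, hy, hvW.trans interior_subset⟩
  · by_contra hne
    obtain ⟨v, hv, hvU⟩ := hptv (e j)
    exact hx (hvU ((hφ0 v x).1 (pos_of_peak_ne_zero hφ (hkψ _ _ hne) hv)))
  · by_contra hne
    have h1 : ∀ s : Q, 0 < s.1.card := fun s =>
      (Finset.mem_filter.1 (Finset.mem_filter.1 s.2).1).2.card_pos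
    refine mul_ne_zero (hkψ _ _ (left_ne_zero_of_mul hne)) (hkψ _ _ (right_ne_zero_of_mul hne))
      (peak_mul_peak (Finset.subset_univ _) (Finset.subset_univ _)
        (fun h => hij (e.injective (Subtype.ext h))) ?_ x)
    have h2 := h1 (e i)
    have h3 := h1 (e j)
    dsimp only at hc
    omega

/-- At most one function of each colour is nonzero at a point, and each is at most `1`. The bound
does not see the number `m` of functions. -/
theorem sum_le_of_coloured {m n : ℕ} {k : Fin m → ℝ} {col : Fin m → ℕ} (hcol : ∀ j, col j ≤ n)
    (h1 : ∑ j, k j ^ 2 ≤ 1)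
    (h2 : ∀ i j, i ≠ j → col i = col j → k i * k j = 0) : ∑ j, k j ≤ n + 1 := by
  classical
  have hle : ∀ j, k j ≤ 1 := fun j => by
    have h3 := (Finset.single_le_sum (fun j _ => sq_nonneg (k j)) (Finset.mem_univ j)).trans h1
    nlinarith
  have hinj : (Finset.univ.filter fun j => k j ≠ 0).card ≤ (Finset.range (n + 1)).card := by
    refine Finset.card_le_card_of_injOn col (fun j _ => ?_) fun i hi j hj hij => ?_
    · simpa using Nat.lt_succ_of_le (hcol j)
    · by_contra hne
      exact mul_ne_zero (Finset.mem_filter.1 hi).2 (Finset.mem_filter.1 hj).2 (h2 i j hne hij)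
  rw [Finset.card_range] at hinj
  rw [← Finset.sum_filter_ne_zero]
  calc _ ≤ ∑ j ∈ Finset.univ.filter fun j => k j ≠ 0, (1 : ℝ) := Finset.sum_le_sum fun j _ => hle j
    _ ≤ n + 1 := by simp only [Finset.sum_const, nsmul_eq_mul, mul_one]; exact_mod_cast hinj

/-! ### Estimates for weighted sums -/

namespace ZeroAtInftyContinuousMap

variable {X : Type*} [TopologicalSpace X]

theorem norm_le_iff {f : C₀(X, ℂ)} {C : ℝ} (hC : 0 ≤ C) : ‖f‖ ≤ C ↔ ∀ x, ‖f x‖ ≤ C := by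
  rw [← norm_toBCF_eq_norm, BoundedContinuousFunction.norm_le hC]
  rfl

theorem norm_apply_le (f : C₀(X, ℂ)) (x : X) : ‖f x‖ ≤ ‖f‖ :=
  (norm_le_iff (norm_nonneg f)).1 le_rfl x

/-- Post-composition with a continuous function that vanishes at `0`. -/
noncomputable def postcomp (g : C(ℂ, ℂ)) (hg : g 0 = 0) (f : C₀(X, ℂ)) : C₀(X, ℂ) where
  toFun x := g (f x)
  continuous_toFun := g.continuous.comp f.continuous_toFun
  zero_at_infty' := by
    have h := (g.continuous.tendsto 0).comp f.zero_at_infty'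
    rwa [hg] at h

theorem postcomp_apply (g : C(ℂ, ℂ)) (hg : g 0 = 0) (f : C₀(X, ℂ)) (x : X) :
    postcomp g hg f x = g (f x) := rfl

/-- The product of a continuous function with values in `[0, 1]` and a function that vanishes at
infinity. -/
noncomputable def ofRealMul (k : C(X, ℝ)) (hk : ∀ x, |k x| ≤ 1) (f : C₀(X, ℂ)) : C₀(X, ℂ) where
  toFun x := k x * f x
  continuous_toFun :=
    (Complex.continuous_ofReal.comp k.continuous).mul f.continuous_toFun
  zero_at_infty' := by
    refine squeeze_zero_norm (fun x => ?_) (by simpa using f.zero_at_infty'.norm)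
    rw [norm_mul, Complex.norm_real, Real.norm_eq_abs]
    exact mul_le_of_le_one_left (norm_nonneg _) (hk x)

theorem ofRealMul_apply (k : C(X, ℝ)) (hk : ∀ x, |k x| ≤ 1) (f : C₀(X, ℂ)) (x : X) :
    ofRealMul k hk f x = k x * f x := rfl

end ZeroAtInftyContinuousMap

/-- Cauchy–Schwarz in the Hilbert module of `ι`-tuples, for `star (g i)` and `star (g i) * d i`; the
square of the second is at most `r ^ 2` times that of the first. -/
theorem CStarAlgebra.norm_sum_star_mul_mul_le {M ι : Type*} [CStarAlgebra M] [Fintype ι]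
    (g d : ι → M) {r : ℝ} (hr : 0 ≤ r) (hd : ∀ i, ‖d i‖ ≤ r) :
    ‖∑ i, star (g i) * d i * g i‖ ≤ ‖∑ i, star (g i) * g i‖ * r := by
  let _ : PartialOrder M := CStarAlgebra.spectralOrder M
  have _ : StarOrderedRing M := CStarAlgebra.spectralOrderedRing M
  let x : WithCStarModule M (ι → M) := (WithCStarModule.equiv M (ι → M)).symm fun i => star (g i)
  let y : WithCStarModule M (ι → M) :=
    (WithCStarModule.equiv M (ι → M)).symm fun i => star (g i) * d i
  have hxx : inner M x x = ∑ i, star (g i) * g i := by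
    rw [WithCStarModule.pi_inner]
    exact Finset.sum_congr rfl fun i _ => congrArg (star (g i) * ·) (star_star (g i))
  have hxy : inner M x y = ∑ i, star (g i) * d i * g i := by
    rw [WithCStarModule.pi_inner]
    exact Finset.sum_congr rfl fun i _ => congrArg (star (g i) * d i * ·) (star_star (g i))
  have hyy : inner M y y = ∑ i, star (g i) * (d i * star (d i)) * g i := by
    rw [WithCStarModule.pi_inner]
    refine Finset.sum_congr rfl fun i _ => ?_
    change star (g i) * d i * star (star (g i) * d i) = _
    simp only [star_mul, star_star, mul_assoc]
  have h0 : 0 ≤ ∑ i, star (g i) * g i := Finset.sum_nonneg fun i _ => star_mul_self_nonneg (g i)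
  have hle : inner M y y ≤ r ^ 2 • ∑ i, star (g i) * g i := by
    rw [hyy, Finset.smul_sum]
    refine Finset.sum_le_sum fun i _ => ?_
    refine (CStarAlgebra.star_left_conjugate_le_norm_smul
      (.mul_star_self (d i))).trans ?_
    refine smul_le_smul_of_nonneg_right ?_ (star_mul_self_nonneg (g i))
    rw [CStarRing.norm_self_mul_star, sq]
    exact mul_self_le_mul_self (norm_nonneg _) (hd i)
  have hx : ‖x‖ ^ 2 = ‖∑ i, star (g i) * g i‖ := by
    rw [← hxx, CStarModule.norm_sq_eq M]
  have hy : ‖y‖ ^ 2 ≤ r ^ 2 * ‖∑ i, star (g i) * g i‖ := by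
    rw [CStarModule.norm_sq_eq M]
    refine (CStarAlgebra.norm_le_norm_of_nonneg_of_le CStarModule.inner_self_nonneg hle).trans ?_
    rw [norm_smul, Real.norm_of_nonneg (sq_nonneg r)]
  have hy' : ‖y‖ ≤ r * ‖x‖ := by
    refine abs_le_of_sq_le_sq' ?_ (by positivity) |>.2
    rwa [mul_pow, hx]
  calc ‖∑ i, star (g i) * d i * g i‖ ≤ ‖x‖ * ‖y‖ := hxy ▸ CStarModule.norm_inner_le _
    _ ≤ ‖x‖ * (r * ‖x‖) := by gcongr
    _ = ‖x‖ ^ 2 * r := by ring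
    _ = _ := by rw [hx]

/-! ### The module action and upper semicontinuity of fibre norms -/

namespace C0AlgebraStructure

variable {X A : Type*} [TopologicalSpace X] [NonUnitalCStarAlgebra A]
variable (S : C0AlgebraStructure X A)

theorem act_add (f : C₀(X, ℂ)) (a b : A) : S.act f (a + b) = S.act f a + S.act f b :=
  map_add (S.toHom f).fst a b

theorem act_sub (f : C₀(X, ℂ)) (a b : A) : S.act f (a - b) = S.act f a - S.act f b :=
  map_sub (S.toHom f).fst a b

theorem act_zero (f : C₀(X, ℂ)) : S.act f 0 = 0 := map_zero (S.toHom f).fst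

theorem act_smul (f : C₀(X, ℂ)) (c : ℂ) (a : A) : S.act f (c • a) = c • S.act f a :=
  map_smul (S.toHom f).fst c a

theorem act_mul_left (f g : C₀(X, ℂ)) (a : A) : S.act (f * g) a = S.act f (S.act g a) := by
  simp only [act, map_mul, DoubleCentralizer.mul_fst]
  rfl

theorem sub_act (f g : C₀(X, ℂ)) (a : A) : S.act (f - g) a = S.act f a - S.act g a := by
  simp only [act, map_sub, DoubleCentralizer.sub_fst]
  rfl

theorem zero_act (a : A) : S.act 0 a = 0 := by
  simp only [act, map_zero, DoubleCentralizer.zero_fst]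
  rfl

theorem sum_act {ι : Type*} (s : Finset ι) (f : ι → C₀(X, ℂ)) (a : A) :
    S.act (∑ i ∈ s, f i) a = ∑ i ∈ s, S.act (f i) a := by
  classical
  induction s using Finset.induction_on with
  | empty => simpa using S.zero_act a
  | insert i s hi ih =>
    rw [Finset.sum_insert hi, Finset.sum_insert hi, ← ih]
    simp only [act, map_add, DoubleCentralizer.add_fst]
    rfl

theorem norm_toHom_le (f : C₀(X, ℂ)) : ‖S.toHom f‖ ≤ ‖f‖ :=
  NonUnitalStarAlgHom.norm_apply_le S.toHom f

theorem norm_act_le (f : C₀(X, ℂ)) (a : A) : ‖S.act f a‖ ≤ ‖f‖ * ‖a‖ := by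
  refine ((S.toHom f).fst.le_opNorm a).trans ?_
  rw [DoubleCentralizer.norm_fst]
  gcongr
  exact S.norm_toHom_le f

theorem coe_act (f : C₀(X, ℂ)) (a : A) :
    (DoubleCentralizer.coe ℂ (S.act f a) : 𝓜(ℂ, A)) = S.toHom f * DoubleCentralizer.coe ℂ a := by
  refine DoubleCentralizer.ext _ _ _ _ (Prod.ext ?_ ?_)
  · ext b
    exact S.act_mul f a b
  · ext b
    exact DoubleCentralizer.central (S.toHom f) b a |>.symm

/-- The fundamental estimate for sums weighted by non-negative functions with bounded sum. -/
theorem norm_sum_act_le {ι : Type*} [Fintype ι] (f : ι → C₀(X, ℂ)) (w : ι → X → ℝ) (c : ι → A)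
    (hf : ∀ i x, f i x = w i x) (hw : ∀ i x, 0 ≤ w i x) {C r : ℝ} (hC : 0 ≤ C)
    (hsum : ∀ x, ∑ i, w i x ≤ C) (hr : 0 ≤ r) (hc : ∀ i, ‖c i‖ ≤ r) :
    ‖∑ i, S.act (f i) (c i)‖ ≤ C * r := by
  -- Each weight is split as a square, and the central square root is put on both sides of `c i`, as
  -- Cauchy–Schwarz requires.
  let q : C(ℂ, ℂ) := ⟨fun z => (Real.sqrt z.re : ℂ),
    Complex.continuous_ofReal.comp (Real.continuous_sqrt.comp Complex.continuous_re)⟩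
  let g : ι → C₀(X, ℂ) := fun i => (f i).postcomp q (by simp [q])
  have hg : ∀ i x, g i x = (Real.sqrt (w i x) : ℂ) := fun i x => by
    simp [g, q, ZeroAtInftyContinuousMap.postcomp_apply, hf]
  have hgg : ∀ i, g i * g i = f i := fun i => by
    ext x
    rw [ZeroAtInftyContinuousMap.mul_apply, hg, hf, ← Complex.ofReal_mul,
      Real.mul_self_sqrt (hw i x)]
  have hgs : ∀ i, star (g i) = g i := fun i => by
    ext x
    rw [ZeroAtInftyContinuousMap.star_apply, hg, Complex.star_def, Complex.conj_ofReal]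
  set G : ι → 𝓜(ℂ, A) := fun i => S.toHom (g i) with hG
  have hGs : ∀ i, star (G i) = G i := fun i => by rw [hG]; simp only; rw [← map_star, hgs]
  have hGG : ∀ i, G i * G i = S.toHom (f i) := fun i => by
    rw [hG]; simp only; rw [← map_mul, hgg]
  have hGc : ∀ i m, G i * m = m * G i := fun i m => ((S.mem_center (g i)).comm m).eq
  let d : ι → 𝓜(ℂ, A) := fun i => DoubleCentralizer.coe ℂ (c i)
  have hd : ∀ i, ‖d i‖ ≤ r := fun i => by
    rw [← DoubleCentralizer.norm_fst]
    refine ContinuousLinearMap.opNorm_le_bound _ hr fun b => ?_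
    exact (norm_mul_le _ _).trans (by gcongr; exact hc i)
  have hsumG : ‖∑ i, G i * G i‖ ≤ C := by
    simp only [hGG]
    rw [← map_sum]
    refine (S.norm_toHom_le _).trans ((ZeroAtInftyContinuousMap.norm_le_iff hC).2 fun x => ?_)
    have : (∑ i, f i) x = ((∑ i, w i x : ℝ) : ℂ) := by
      rw [Complex.ofReal_sum, ← Finset.sum_congr rfl fun i _ => hf i x]
      exact map_sum (⟨⟨fun f : C₀(X, ℂ) => f x, rfl⟩, fun _ _ => rfl⟩ : C₀(X, ℂ) →+ ℂ)
        f Finset.univ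
    rw [this, Complex.norm_real, Real.norm_eq_abs,
      abs_of_nonneg (Finset.sum_nonneg fun i _ => hw i x)]
    exact hsum x
  have hmain := CStarAlgebra.norm_sum_star_mul_mul_le G d hr hd
  simp only [hGs] at hmain
  have hact : ∑ i, G i * d i * G i = DoubleCentralizer.coeHom (∑ i, S.act (f i) (c i)) := by
    rw [map_sum]
    refine Finset.sum_congr rfl fun i _ => ?_
    rw [mul_assoc, ← hGc, ← mul_assoc, hGG]
    exact (S.coe_act _ _).symm
  rw [hact, NonUnitalStarAlgHom.norm_map _ fun a b hab => ?_] at hmain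
  · exact hmain.trans (by gcongr)
  · refine eq_of_mul_left_eq fun x => ?_
    exact congrArg (fun m : 𝓜(ℂ, A) => m.fst x) hab

/-- For a generator `S.act f a` with `f x = 0`, `e * f` is small once `e` lives where `f` is small.
Sums, scalars and norm limits preserve this, as `e` acts contractively. -/
theorem eventually_norm_act_lt_of_mem_fibreIdeal {x : X} {b : A} (hb : b ∈ S.fibreIdeal x)
    {η : ℝ} (hη : 0 < η) :
    ∀ᶠ U in (𝓝 x).smallSets, ∀ e : C₀(X, ℂ), ‖e‖ ≤ 1 → (∀ y ∉ U, e y = 0) →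
      ‖S.act e b‖ < η := by
  obtain ⟨b', hb', hbb⟩ := Metric.mem_closure_iff.1 hb (η / 2) (half_pos hη)
  suffices h : ∀ η > 0, ∀ᶠ U in (𝓝 x).smallSets, ∀ e : C₀(X, ℂ), ‖e‖ ≤ 1 →
      (∀ y ∉ U, e y = 0) → ‖S.act e b'‖ < η by
    filter_upwards [h (η / 2) (half_pos hη)] with U hU e he heU
    have h1 : ‖S.act e (b - b')‖ < η / 2 :=
      ((S.norm_act_le e _).trans (mul_le_of_le_one_left (norm_nonneg _) he)).trans_lt
        (by rwa [← dist_eq_norm])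
    calc ‖S.act e b‖ = ‖S.act e (b - b') + S.act e b'‖ := by rw [← act_add, sub_add_cancel]
      _ ≤ ‖S.act e (b - b')‖ + ‖S.act e b'‖ := norm_add_le _ _
      _ < η := by linarith [hU e he heU]
  clear hbb hb hη
  induction hb' using Submodule.span_induction with
  | mem b hb =>
    obtain ⟨f, a, hf, rfl⟩ := hb
    intro η hη
    have hδ : 0 < η / (‖a‖ + 1) := by positivity
    have hN : {y | ‖f y‖ < η / (‖a‖ + 1)} ∈ 𝓝 x :=
      Tendsto.eventually_lt_const (v := ‖f x‖) (by simpa [hf] using hδ)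
        (map_continuous f).norm.continuousAt
    filter_upwards [eventually_smallSets_subset.2 hN] with U hU e he heU
    rw [← act_mul_left]
    have h1 : ‖e * f‖ ≤ η / (‖a‖ + 1) := by
      refine (ZeroAtInftyContinuousMap.norm_le_iff hδ.le).2 fun y => ?_
      rw [ZeroAtInftyContinuousMap.mul_apply, norm_mul]
      by_cases hy : y ∈ U
      · refine (mul_le_of_le_one_left (norm_nonneg _) ?_).trans (hU hy).le
        exact (e.norm_apply_le y).trans he
      · simpa [heU y hy] using hδ.le
    calc ‖S.act (e * f) a‖ ≤ η / (‖a‖ + 1) * ‖a‖ := (S.norm_act_le _ _).trans (by gcongr)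
      _ < η / (‖a‖ + 1) * (‖a‖ + 1) := by gcongr; exact lt_add_one _
      _ = η := by field_simp
  | zero =>
    intro η hη
    exact Eventually.of_forall fun U e _ _ => by simpa [act_zero] using hη
  | add a b _ _ ha hb =>
    intro η hη
    filter_upwards [ha (η / 2) (half_pos hη), hb (η / 2) (half_pos hη)] with U h1 h2 e he heU
    rw [act_add]
    refine (norm_add_le _ _).trans_lt ?_
    linarith [h1 e he heU, h2 e he heU]
  | smul c a _ ha =>
    intro η hη
    filter_upwards [ha (η / (‖c‖ + 1)) (by positivity)] with U hU e he heU
    rw [act_smul, norm_smul]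
    calc ‖c‖ * ‖S.act e a‖ ≤ ‖c‖ * (η / (‖c‖ + 1)) := by gcongr; exact (hU e he heU).le
      _ < (‖c‖ + 1) * (η / (‖c‖ + 1)) := by gcongr; exact lt_add_one _
      _ = η := by field_simp

/-- Upper semicontinuity of the fibre norms. -/
theorem eventually_norm_act_lt {x : X} {c : A} {r : ℝ}
    (hc : ‖CStarQuotient.mk (S.fibreIdeal x) c‖ < r) :
    ∀ᶠ U in (𝓝 x).smallSets, ∀ e : C₀(X, ℂ), ‖e‖ ≤ 1 → (∀ y ∉ U, e y = 0) →
      ‖S.act e c‖ < r := by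
  -- Choose a lift `d` of norm below `r`; the rest `c - d` lies in the fibre ideal.
  obtain ⟨d, hd, hdr⟩ := CStarQuotient.exists_mk_eq_norm_lt (S.fibreIdeal x)
    (CStarQuotient.mk (S.fibreIdeal x) c) (sub_pos.2 hc)
  rw [add_sub_cancel] at hdr
  have hm : c - d ∈ S.fibreIdeal x := (CStarQuotient.mk_eq_mk _).1 hd.symm
  filter_upwards [S.eventually_norm_act_lt_of_mem_fibreIdeal hm (sub_pos.2 hdr)] with U hU e he heU
  calc ‖S.act e c‖ = ‖S.act e (c - d) + S.act e d‖ := by rw [← act_add, sub_add_cancel]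
    _ ≤ ‖S.act e (c - d)‖ + ‖S.act e d‖ := norm_add_le _ _
    _ < (r - ‖d‖) + ‖d‖ := add_lt_add_of_lt_of_le (hU e he heU)
        ((S.norm_act_le e d).trans (mul_le_of_le_one_left (norm_nonneg _) he))
    _ = r := by ring

end C0AlgebraStructure

/-! ### Local copies and gluing -/

namespace C0AlgebraStructure

variable {X A : Type*} [TopologicalSpace X] [NonUnitalCStarAlgebra A]
variable (S : C0AlgebraStructure X A)

/-- Near `x`, the element `y` witnesses `HasOrthogonalCopies` for the data `a`, `F`, `ε`. -/
def IsLocalCopy (a : A) (F : Finset A) (ε : ℝ) (x : X) (y : A) : Prop :=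
  ∀ᶠ U in (𝓝 x).smallSets, ∀ e : C₀(X, ℂ), ‖e‖ ≤ 1 → (∀ z ∉ U, e z = 0) →
    ‖S.act e (star y * y - star a * a)‖ < ε ∧ ∀ b ∈ F, ‖S.act e (b * y)‖ < ε

variable {S}

theorem exists_isLocalCopy {x : X} (h : HasOrthogonalCopies (S.Fibre x)) (a : A) (F : Finset A)
    {ε : ℝ} (hε : 0 < ε) : ∃ y, S.IsLocalCopy a F ε x y := by
  classical
  obtain ⟨y, hy, hF⟩ := h (CStarQuotient.mk _ a) (F.image (CStarQuotient.mk _)) ε hε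
  obtain ⟨y, rfl⟩ := CStarQuotient.mk_surjective _ y
  rw [← CStarQuotient.mk_star, ← CStarQuotient.mk_star, ← CStarQuotient.mk_mul,
    ← CStarQuotient.mk_mul, ← map_sub] at hy
  refine ⟨y, ?_⟩
  have hb : ∀ b ∈ F, ∀ᶠ U in (𝓝 x).smallSets, ∀ e : C₀(X, ℂ), ‖e‖ ≤ 1 →
      (∀ z ∉ U, e z = 0) → ‖S.act e (b * y)‖ < ε := fun b hb => by
    refine S.eventually_norm_act_lt ?_
    rw [CStarQuotient.mk_mul]
    exact hF _ (Finset.mem_image_of_mem _ hb)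
  filter_upwards [S.eventually_norm_act_lt hy, (eventually_all_finset F).2 hb] with U h1 h2 e he heU
  exact ⟨h1 e he heU, fun b hb => h2 b hb e he heU⟩

theorem IsLocalCopy.eventually {a : A} {F : Finset A} {ε : ℝ} {x : X} {y : A}
    (h : S.IsLocalCopy a F ε x y) : ∀ᶠ z in 𝓝 x, S.IsLocalCopy a F ε z y := by
  obtain ⟨s, hs, hsP⟩ := h.exists_mem_of_smallSets
  filter_upwards [eventually_eventually_nhds.2 hs] with z hz
  filter_upwards [eventually_smallSets_subset.2 hz] with U hU e he heU
  exact hsP e he fun w hw => heU w fun hwU => hw (hU hwU)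

/-- Finiteness of `Y` allows the next level to be made orthogonal to every candidate of this one. -/
theorem exists_finset_isLocalCopy (h : ∀ x, HasOrthogonalCopies (S.Fibre x)) {K : Set X}
    (hK : IsCompact K) (a : A) (F : Finset A) {ε : ℝ} (hε : 0 < ε) :
    ∃ Y : Finset A, ∀ x ∈ K, ∃ y ∈ Y, S.IsLocalCopy a F ε x y := by
  classical
  refine hK.induction_on (p := fun K => ∃ Y : Finset A, ∀ x ∈ K, ∃ y ∈ Y, S.IsLocalCopy a F ε x y)
    ⟨∅, by simp⟩ (fun s t hst ⟨Y, hY⟩ => ⟨Y, fun x hx => hY x (hst hx)⟩) ?_ fun x _ => ?_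
  · rintro s t ⟨Y, hY⟩ ⟨Z, hZ⟩
    refine ⟨Y ∪ Z, ?_⟩
    rintro x (hx | hx)
    · obtain ⟨y, hy, h⟩ := hY x hx
      exact ⟨y, Finset.mem_union_left _ hy, h⟩
    · obtain ⟨y, hy, h⟩ := hZ x hx
      exact ⟨y, Finset.mem_union_right _ hy, h⟩
  · obtain ⟨y, hy⟩ := exists_isLocalCopy (h x) a F hε
    exact ⟨_, mem_nhdsWithin_of_mem_nhds hy.eventually, {y}, fun z hz => ⟨y, by simp, hz⟩⟩

/-- Local copies on a compact set in successive levels, each orthogonal to the preceding ones. -/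
theorem exists_isLocalCopy_levels (h : ∀ x, HasOrthogonalCopies (S.Fibre x)) {K : Set X}
    (hK : IsCompact K) (a : A) (F : Finset A) {ε : ℝ} (hε : 0 < ε) :
    ∃ (G : ℕ → Finset A) (y : ℕ → X → A), (∀ i, F ⊆ G i) ∧
      (∀ i j, i < j → ∀ x ∈ K, star (y i x) ∈ G j) ∧
      ∀ i, ∀ x ∈ K, S.IsLocalCopy a (G i) ε x (y i x) := by
  classical
  choose Y hY using fun F => exists_finset_isLocalCopy h hK a F hε
  -- Adjoints are added because smallness of `b * y` for `b = star y'` is what kills the cross term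
  -- `star y' * y`.
  let G : ℕ → Finset A := fun i => Nat.rec F (fun _ G => G ∪ (Y G).image star) i
  have hG : ∀ i, G (i + 1) = G i ∪ (Y (G i)).image star := fun _ => rfl
  have hmono : Monotone G := monotone_nat_of_le_succ fun i => by
    rw [hG]; exact Finset.subset_union_left
  choose! y hyY hy using fun i x (hx : x ∈ K) => hY (G i) x hx
  refine ⟨G, y, fun i => hmono (Nat.zero_le i), fun i j hij x hx => ?_, hy⟩
  refine hmono (Nat.succ_le_of_lt hij) ?_
  rw [Nat.succ_eq_add_one, hG]
  exact Finset.mem_union_right _ (Finset.mem_image_of_mem _ (hyY i x hx))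

/-- A compactly supported Urysohn function. Equality with `1` near `x` gives `f * e = f` for
functions `f` supported there. -/
theorem _root_.ZeroAtInftyContinuousMap.exists_eventually_eq_one {X : Type*} [TopologicalSpace X]
    [LocallyCompactSpace X] [RegularSpace X] {x : X} {s : Set X} (hs : s ∈ 𝓝 x) :
    ∃ e : C₀(X, ℂ), ‖e‖ ≤ 1 ∧ (∀ z ∉ s, e z = 0) ∧ ∀ᶠ z in 𝓝 x, e z = 1 := by
  obtain ⟨K, hK, hKs, hKc⟩ := local_compact_nhds (interior_mem_nhds.2 hs)
  obtain ⟨f, hf1, hf0, hfc, hf⟩ := exists_continuous_one_zero_of_isCompact hKc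
    isOpen_interior.isClosed_compl (Set.disjoint_compl_right_iff_subset.2 hKs)
  let e : C₀(X, ℂ) :=
    { toFun := fun z => f z
      continuous_toFun := Complex.continuous_ofReal.comp f.continuous
      zero_at_infty' := (hfc.comp_left (g := ((↑) : ℝ → ℂ)) Complex.ofReal_zero).is_zero_at_infty }
  have he : ∀ z, e z = (f z : ℂ) := fun _ => rfl
  refine ⟨e, (ZeroAtInftyContinuousMap.norm_le_iff zero_le_one).2 fun z => ?_, fun z hz => ?_, ?_⟩
  · rw [he, Complex.norm_real, Real.norm_of_nonneg (hf z).1]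
    exact (hf z).2
  · rw [he, hf0 fun h => hz (interior_subset h)]
    simp
  · filter_upwards [hK] with z hz
    rw [he, hf1 hz]
    simp

/-- The estimates for elements glued from local data. -/
theorem norm_glued_estimates {ι : Type*} [Fintype ι] {k : ι → X → ℝ} {f e : ι → C₀(X, ℂ)}
    {col : ι → ℕ} {n : ℕ} {y : ι → A} {a : A} {ε : ℝ} (hε : 0 ≤ ε)
    (hk : ∀ j z, 0 ≤ k j z) (hsum : ∀ z, ∑ j, k j z ≤ n + 1) (hf : ∀ j z, f j z = k j z)
    (hfe : ∀ j, f j * e j = f j)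
    (hcol : ∀ i j, i ≠ j → col i = col j → ∀ z, k i z * k j z = 0)
    (hdiag : ∀ j, ‖S.act (e j) (star (y j) * y j - star a * a)‖ ≤ ε)
    (hoff : ∀ i j, col i < col j → ‖S.act (e j) (star (y i) * y j)‖ ≤ ε) :
    ‖star (∑ j, S.act (f j) (y j)) * (∑ j, S.act (f j) (y j)) -
      S.act (∑ j, f j * f j) (star a * a)‖ ≤ (n + 1) ^ 2 * ε ∧
    ∀ b : A, (∀ j, ‖S.act (e j) (b * y j)‖ ≤ ε) →
      ‖b * ∑ j, S.act (f j) (y j)‖ ≤ (n + 1) * ε := by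
  classical
  have hfs : ∀ j, star (f j) = f j := fun j => by
    ext z
    rw [ZeroAtInftyContinuousMap.star_apply, hf, Complex.star_def, Complex.conj_ofReal]
  refine ⟨?_, fun b hb => ?_⟩
  -- Expanding the product, the `(i, j)` term is `f i * f j` acting on an element that a bump
  -- function makes `ε`-small. The bump is that of the larger colour, by adjoints if this is `i`.
  -- Distinct indices of equal colour have `f i * f j = 0`, so `0` serves.
  · let c : ι × ι → A := fun p =>
      if p.1 = p.2 then S.act (e p.2) (star (y p.1) * y p.2 - star a * a)
      else if col p.1 < col p.2 then S.act (e p.2) (star (y p.1) * y p.2)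
      else if col p.2 < col p.1 then S.act (star (e p.1)) (star (y p.1) * y p.2)
      else 0
    have hc : ∀ p, ‖c p‖ ≤ ε := by
      rintro ⟨i, j⟩
      simp only [c]
      split_ifs with h1 h2 h3
      · subst h1; exact hdiag i
      · exact hoff i j h2
      · rw [← norm_star, star_act, star_mul, star_star, star_star]
        exact hoff j i h3
      · simpa using hε
    have hkey : star (∑ j, S.act (f j) (y j)) * (∑ j, S.act (f j) (y j)) -
        S.act (∑ j, f j * f j) (star a * a) = ∑ p : ι × ι, S.act (f p.1 * f p.2) (c p) := by
      have hd : S.act (∑ j, f j * f j) (star a * a) =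
          ∑ p : ι × ι, S.act (f p.1 * f p.2) (if p.1 = p.2 then star a * a else 0) := by
        rw [S.sum_act, Fintype.sum_prod_type]
        refine Finset.sum_congr rfl fun i _ => ?_
        rw [Finset.sum_eq_single i (fun j _ hj => by rw [if_neg hj.symm, act_zero]) (by simp)]
        simp
      rw [hd, star_sum, Finset.sum_mul_sum, ← Fintype.sum_prod_type', ← Finset.sum_sub_distrib]
      refine Finset.sum_congr rfl fun p _ => ?_
      rw [star_act, hfs, act_mul, mul_act, ← act_mul_left, ← act_sub]
      have h2 : f p.1 * f p.2 * e p.2 = f p.1 * f p.2 := by rw [mul_assoc, hfe]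
      have h1 : f p.1 * f p.2 * star (e p.1) = f p.1 * f p.2 := by
        have h : f p.1 * star (e p.1) = f p.1 := by
          ext z
          have h := congrArg (fun g : C₀(X, ℂ) => star g z) (hfe p.1)
          simpa [hf] using h
        rw [mul_right_comm, h]
      simp only [c]
      split_ifs with h3 h4 h5
      · rw [← act_mul_left, h2]
      · rw [← act_mul_left, h2, sub_zero]
      · rw [← act_mul_left, h1, sub_zero]
      · have h0 : f p.1 * f p.2 = 0 := by
          ext z
          rw [ZeroAtInftyContinuousMap.mul_apply, hf, hf, ← Complex.ofReal_mul,
            hcol _ _ h3 (by omega) z]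
          simp
        rw [h0, zero_act, zero_act]
    rw [hkey]
    refine S.norm_sum_act_le _ (fun p z => k p.1 z * k p.2 z) c (fun p z => ?_)
      (fun p z => mul_nonneg (hk _ _) (hk _ _)) (by positivity) (fun z => ?_) hε hc
    · rw [ZeroAtInftyContinuousMap.mul_apply, hf, hf, Complex.ofReal_mul]
    · rw [Fintype.sum_prod_type]
      change ∑ i, ∑ j, k i z * k j z ≤ _
      rw [← Finset.sum_mul_sum, sq]
      exact mul_self_le_mul_self (Finset.sum_nonneg fun j _ => hk j z) (hsum z)
  · have hkey : b * ∑ j, S.act (f j) (y j) = ∑ j, S.act (f j) (S.act (e j) (b * y j)) := by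
      rw [Finset.mul_sum]
      refine Finset.sum_congr rfl fun j _ => ?_
      rw [mul_act, ← act_mul_left, hfe]
    rw [hkey]
    exact S.norm_sum_act_le f k _ hf hk (by positivity) hsum hε hb

/-- `h` nearly fixes `c` and `κ` nearly fixes `h`, so `κ` nearly fixes `c`. -/
theorem norm_act_sub_self_le {h κ : C₀(X, ℂ)} {c : A} {ε δ : ℝ} (hh : ‖S.act h c - c‖ ≤ ε)
    (hκ : ‖κ‖ ≤ 1) (hκh : ‖κ * h - h‖ ≤ δ) : ‖S.act κ c - c‖ ≤ 2 * ε + δ * ‖c‖ := by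
  have h1 : S.act κ c - c = S.act (κ * h - h) c + (S.act h c - c) - S.act κ (S.act h c - c) := by
    rw [sub_act, act_sub, act_mul_left]
    abel
  have h2 : ‖S.act κ (S.act h c - c)‖ ≤ ε :=
    (S.norm_act_le _ _).trans ((mul_le_of_le_one_left (norm_nonneg _) hκ).trans hh)
  have h3 : ‖S.act (κ * h - h) c‖ ≤ δ * ‖c‖ := (S.norm_act_le _ _).trans (by gcongr)
  rw [h1]
  refine (norm_sub_le _ _).trans ?_
  linarith [norm_add_le (S.act (κ * h - h) c) (S.act h c - c)]

theorem hasOrthogonalCopies_of_fibres [LocallyCompactSpace X] [TopologicalSpace.MetrizableSpace X]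
    (hX : FiniteCoveringDim X) (hS : ∀ x, HasOrthogonalCopies (S.Fibre x)) :
    HasOrthogonalCopies A := by
  obtain ⟨n, hX⟩ := hX
  intro a F ε₀ hε₀
  set N : ℝ := (n + 1) ^ 2 with hN
  have hN0 : (1 : ℝ) ≤ N := one_le_pow₀ (by linarith [n.cast_nonneg (α := ℝ)])
  -- Gluing costs `N * ε`, replacing `κ` by the identity at most `3 * ε`; the spare `ε` makes the
  -- inequality strict.
  set ε : ℝ := ε₀ / (N + 4) with hεdef
  have hε : 0 < ε := by positivity
  have hεε : (N + 4) * ε = ε₀ := by rw [hεdef]; field_simp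
  obtain ⟨h, hh⟩ : ∃ h : C₀(X, ℂ), ‖S.act h (star a * a) - star a * a‖ < ε := by
    obtain ⟨l, hl, ht⟩ := S.nondegenerate
    have := hl.neBot
    obtain ⟨h, hh⟩ := (Metric.tendsto_nhds.1 (ht (star a * a)) ε hε).exists
    exact ⟨h, by rwa [dist_eq_norm] at hh⟩
  set δ : ℝ := ε / (‖star a * a‖ + 1)
  have hδ : 0 < δ := by positivity
  have hδc : δ * ‖star a * a‖ ≤ ε := by
    calc δ * ‖star a * a‖ ≤ δ * (‖star a * a‖ + 1) := by gcongr; linarith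
      _ = ε := by simp only [δ]; field_simp
  obtain ⟨K, hK, hKh⟩ := mem_cocompact.1
    (Tendsto.eventually_lt_const (v := 0) hδ (by simpa using h.zero_at_infty'.norm))
  obtain ⟨G, y, hFG, hyG, hy⟩ := exists_isLocalCopy_levels hS hK a F hε
  -- One bump function per point serves all levels `0, …, n` at once.
  have hloc : ∀ x ∈ K, ∃ e : C₀(X, ℂ), (∀ᶠ z in 𝓝 x, e z = 1) ∧ ∀ i ≤ n,
      ‖S.act e (star (y i x) * y i x - star a * a)‖ < ε ∧
        ∀ b ∈ G i, ‖S.act e (b * y i x)‖ < ε := fun x hx => by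
    have hall := (eventually_all_finset (Finset.range (n + 1))).2 fun i _ => hy i x hx
    obtain ⟨s, hs, hsP⟩ := hall.exists_mem_of_smallSets
    obtain ⟨e, he1, hes, hex⟩ := ZeroAtInftyContinuousMap.exists_eventually_eq_one hs
    exact ⟨e, hex, fun i hi => hsP i (Finset.mem_range_succ_iff.2 hi) e he1 hes⟩
  choose! e he1 heP using hloc
  obtain ⟨m, k, pt, col, hpt, hk0, hk1, hkK, hkU, hkcol⟩ :=
    hX.exists_coloured_partition hK (fun x => {z | e x z = 1}) he1
  have hk_le : ∀ j z, |k j z| ≤ 1 := fun j z => by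
    rw [← sq_le_one_iff_abs_le_one]
    exact (Finset.single_le_sum (f := fun j => k j z ^ 2) (fun i _ => sq_nonneg _)
      (Finset.mem_univ j)).trans (hk1 z)
  -- The factor `e (pt j)` only forces vanishing at infinity: it is `1` wherever `k j` is nonzero.
  let f : Fin m → C₀(X, ℂ) := fun j => .ofRealMul (k j) (hk_le j) (e (pt j))
  have hf : ∀ j z, f j z = k j z := fun j z => by
    rw [ZeroAtInftyContinuousMap.ofRealMul_apply]
    by_cases hz : e (pt j) z = 1
    · rw [hz, mul_one]
    · rw [hkU j z hz]; simp
  have hfe : ∀ j, f j * e (pt j) = f j := fun j => by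
    ext z
    rw [ZeroAtInftyContinuousMap.mul_apply, hf]
    by_cases hz : e (pt j) z = 1
    · rw [hz, mul_one]
    · rw [hkU j z hz]; simp
  obtain ⟨hx, hb⟩ := norm_glued_estimates (S := S) (k := fun j => k j) (f := f)
    (e := fun j => e (pt j)) (col := col) (n := n) (y := fun j => y (col j) (pt j)) (a := a)
    hε.le hk0 (fun z => sum_le_of_coloured (fun j => (hpt j).2) (hk1 z)
      fun i j hij hc => hkcol i j hij hc z) hf hfe hkcol
    (fun j => (heP _ (hpt j).1 _ (hpt j).2).1.le)
    (fun i j hij => ((heP _ (hpt j).1 _ (hpt j).2).2 _ (hyG _ _ hij _ (hpt i).1)).le)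
  set κ : C₀(X, ℂ) := ∑ j, f j * f j with hκdef
  have hκ : ∀ z, κ z = ((∑ j, k j z ^ 2 : ℝ) : ℂ) := fun z => by
    rw [Complex.ofReal_sum, hκdef]
    refine (map_sum (⟨⟨fun f : C₀(X, ℂ) => f z, rfl⟩, fun _ _ => rfl⟩ : C₀(X, ℂ) →+ ℂ)
      (fun j => f j * f j) Finset.univ).trans (Finset.sum_congr rfl fun j _ => ?_)
    change (f j * f j) z = _
    rw [ZeroAtInftyContinuousMap.mul_apply, hf, sq, Complex.ofReal_mul]
  have hκ1 : ‖κ‖ ≤ 1 := (ZeroAtInftyContinuousMap.norm_le_iff zero_le_one).2 fun z => by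
    rw [hκ, Complex.norm_real, Real.norm_of_nonneg (Finset.sum_nonneg fun j _ => sq_nonneg _)]
    exact hk1 z
  -- On `K` the squares sum to `1`; off `K` the function `h` is already below `δ`.
  have hκh : ‖κ * h - h‖ ≤ δ := (ZeroAtInftyContinuousMap.norm_le_iff hδ.le).2 fun z => by
    rw [ZeroAtInftyContinuousMap.sub_apply, ZeroAtInftyContinuousMap.mul_apply, hκ]
    by_cases hz : z ∈ K
    · simpa [hkK z hz] using hδ.le
    · have h1 : ‖h z‖ < δ := hKh hz
      have h2 : ((∑ j, k j z ^ 2 : ℝ) : ℂ) * h z - h z =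
          ((∑ j, k j z ^ 2 - 1 : ℝ) : ℂ) * h z := by push_cast; ring
      rw [h2, norm_mul, Complex.norm_real]
      refine (mul_le_of_le_one_left (norm_nonneg _) ?_).trans h1.le
      rw [Real.norm_eq_abs, abs_le]
      constructor <;> linarith [hk1 z, Finset.sum_nonneg fun j (_ : j ∈ Finset.univ) =>
        sq_nonneg (k j z)]
  have hκa := norm_act_sub_self_le hh.le hκ1 hκh
  refine ⟨∑ j, S.act (f j) (y (col j) (pt j)), lt_of_le_of_lt (norm_sub_le_norm_sub_add_norm_sub _ (S.act κ (star a * a)) _) ?_,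
    fun b hbF => ?_⟩
  · rw [← hεε]
    linarith
  · refine (hb b fun j => ((heP _ (hpt j).1 _ (hpt j).2).2 _ (hFG _ hbF)).le).trans_lt ?_
    have : (n : ℝ) + 1 ≤ N := by
      rw [hN]
      exact le_self_pow₀ (by linarith [n.cast_nonneg (α := ℝ)]) two_ne_zero
    rw [← hεε]
    nlinarith

end C0AlgebraStructure

/-! ### The theorem -/

theorem mainTheorem2 {X : Type*} [TopologicalSpace X] [LocallyCompactSpace X]
    [TopologicalSpace.MetrizableSpace X] (hX : FiniteCoveringDim X)
    {A : Type*} [NonUnitalCStarAlgebra A] [TopologicalSpace.SeparableSpace A]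
    (S : C0AlgebraStructure X A) :
    IsStable A ↔ ∀ x : X, IsStable (S.Fibre x) := by
  refine ⟨fun h x => ?_, fun h =>
    (C0AlgebraStructure.hasOrthogonalCopies_of_fibres hX fun x => (h x).hasOrthogonalCopies).isStable⟩
  have hs : Function.Surjective (CStarQuotient.mkHom (S.fibreIdeal x)) :=
    CStarQuotient.mk_surjective _
  have hc : Continuous (CStarQuotient.mkHom (S.fibreIdeal x)) :=
    AddMonoidHomClass.continuous_of_bound (CStarQuotient.mkHom (S.fibreIdeal x)) 1 fun a =>
      (CStarQuotient.norm_mk_le (S.fibreIdeal x) a).trans_eq (one_mul _).symm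
  have : TopologicalSpace.SeparableSpace (S.Fibre x) := hs.denseRange.separableSpace hc
  exact (h.hasOrthogonalCopies.of_surjective _ hs).isStable
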